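/- For $n\ge 2$ let $W_n$ be the $\mathbb{Q}$-vector space with basis $\{w_{ij}\mid 1\le i<j\le n\}$; put $w_{ji}=w_{ij}$ and let the symmetric group $\mathcal{S}_n$ act linearly by $\pi\cdot w_{ij}=w_{\pi(i)\pi(j)}$. Let $\Lambda^2(n)=\Lambda^2 W_n$ be the degree two component of the exterior algebra of $W_n$, with the induced action of $\mathcal{S}_n$. For a partition $\lambda$ of $n$ let $V_\lambda$ be the irreducible $\mathbb{Q}[\mathcal{S}_n]$-module corresponding to $\lambda$ (the span of the polytabloids of shape $\lambda$; thus $V_{(n)}$ is the trivial module and $V_{(1,\dots,1)}$ is the sign module), and for a partition $\mu=(\mu_1\ge\dots\ge\mu_s)$ with $n-\sum_i\mu_i\ge\mu_1$ put $V(\mu)_n=V_{(n-\sum_i\mu_i,\,\mu_1,\dots,\mu_s)}$. Write $mV$ for the direct sum of $m$ copies of $V$. Then, for every $n\ge 7$, there is an isomorphism of $\mathcal{S}_n$-modules $$\Lambda^2(n)\cong 2V(1)_n\oplus 2V(2)_n\oplus 3V(1,1)_n\oplus V(3)_n\oplus 2V(2,1)_n\oplus V(1,1,1)_n\oplus V(3,1)_n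 .$$ For $n=2,\dots,6$ there are isomorphisms of $\mathcal{S}_n$-modules $$\begin{aligned} \Lambda^2(2)&= 0,\\ \Lambda^2(3)&\cong V_{(2,1)}\oplus V_{(1,1,1)},\\ \Lambda^2(4)&\cong 2V_{(3,1)}\oplus V_{(2,2)}\oplus 2V_{(2,1,1)}\oplus V_{(1,1,1,1)},\\ \Lambda^2(5)&\cong 2V_{(4,1)}\oplus 2V_{(3,2)}\oplus 3V_{(3,1,1)}\oplus V_{(2,2,1)}\oplus V_{(2,1,1,1)},\\ \Lambda^2(6)&\cong 2V_{(5,1)}\oplus 2V_{(4,2)}\oplus 3V_{(4,1,1)}\oplus V_{(3,3)}\oplus 2V_{(3,2,1)}\oplus V_{(3,1,1,1)}. \end{aligned}$$ -/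

import Mathlib

open scoped DirectSum

noncomputable section

namespace SymRep

/-! ### The span of the generators `w_ij` and its exterior square -/

/-- The index set of the generators `w_ij`, `i ≠ j`, with the convention `w_ij = w_ji`:
unordered pairs of distinct elements of an `n`-element set. -/
def Edge (n : ℕ) : Type := {e : Sym2 (Fin n) // ¬ e.IsDiag}

/-- The action `π • {i, j} = {π i, π j}` on unordered pairs. -/
instance (n : ℕ) : MulAction (Equiv.Perm (Fin n)) (Edge n) where
  smul π e := ⟨Sym2.map π e.1, fun h => e.2 ((Sym2.isDiag_map π.injective).1 h)⟩
  one_smul e := Subtype.ext (by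
    change Sym2.map _ e.1 = e.1
    simp)
  mul_smul π τ e := Subtype.ext (by
    change Sym2.map _ e.1 = Sym2.map π (Sym2.map τ e.1)
    rw [Sym2.map_map]
    rfl)

/-- The rational span of the `w_ij`, with `π • w_ij = w_{π(i)π(j)}`. -/
abbrev edgeRep (n : ℕ) :
    Representation ℚ (Equiv.Perm (Fin n)) (MonoidAlgebra ℚ (Edge n)) :=
  Representation.ofMulAction ℚ (Equiv.Perm (Fin n)) (Edge n)

/-- The `k`-th exterior power of a representation: `g` acts by
`v₁ ∧ ⋯ ∧ v_k ↦ g v₁ ∧ ⋯ ∧ g v_k`. -/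
def extPowRep {G W : Type*} [Group G] [AddCommGroup W] [Module ℚ W]
    (ρ : Representation ℚ G W) (k : ℕ) : Representation ℚ G (⋀[ℚ]^k W) where
  toFun g := exteriorPower.map k (ρ g)
  map_one' := by
    rw [map_one]
    exact exteriorPower.map_id
  map_mul' g h := by
    rw [map_mul]
    exact exteriorPower.map_comp _ _

/-- `Λ²(n)`: the degree two component of the exterior algebra on the `w_ij`. -/
abbrev LambdaTwo (n : ℕ) :
    Representation ℚ (Equiv.Perm (Fin n)) (⋀[ℚ]^2 (MonoidAlgebra ℚ (Edge n))) :=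
  extPowRep (edgeRep n) 2

/-! ### The irreducible modules `V_λ`, realised by polytabloids

Below `l = [λ₁, λ₂, …, λ_t]` is the list of row lengths of a partition of `n`. -/

/-- A Young tableau of shape `l`: a bijection from the entries `0, …, n - 1` to the cells of the
diagram, a cell being a pair (row, column) with the column smaller than the length of the row. -/
abbrev Tableau (n : ℕ) (l : List ℕ) : Type :=
  Fin n ≃ (Σ i : Fin l.length, Fin (l.get i))

/-- A tabloid of shape `l`, that is, a row equivalence class of tableaux: the function which maps
each entry to its row, row `i` having exactly `l.get i` entries. -/
def Tabloid (n : ℕ) (l : List ℕ) : Type :=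
  {r : Fin n → Fin l.length // ∀ i, Fintype.card {a : Fin n // r a = i} = l.get i}

/-- `π` acts on tabloids by replacing each entry `a` by `π a`. -/
instance (n : ℕ) (l : List ℕ) : MulAction (Equiv.Perm (Fin n)) (Tabloid n l) where
  smul π r := ⟨fun a => r.1 (π⁻¹ a), fun i => by
    rw [← r.2 i]
    exact Fintype.card_congr ((π⁻¹).subtypeEquiv fun _ => Iff.rfl)⟩
  one_smul _ := rfl
  mul_smul π τ r := Subtype.ext (funext fun a => by
    change r.1 ((π * τ)⁻¹ a) = r.1 (τ⁻¹ (π⁻¹ a))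
    rw [mul_inv_rev]
    rfl)

/-- The row equivalence class `{t}` of a tableau `t`. -/
def Tableau.tabloid {n : ℕ} {l : List ℕ} (t : Tableau n l) : Tabloid n l :=
  ⟨fun a => (t a).1, fun i => by
    have e : {a : Fin n // (t a).1 = i} ≃ Fin (l.get i) :=
      (t.subtypeEquiv (q := fun c => c.1 = i) fun _ => Iff.rfl).trans
        (Equiv.sigmaSubtype i)
    rw [Fintype.card_congr e, Fintype.card_fin]⟩

/-- The permutation module spanned by the tabloids of shape `l`. -/
abbrev tabloidRep (n : ℕ) (l : List ℕ) :
    Representation ℚ (Equiv.Perm (Fin n)) (MonoidAlgebra ℚ (Tabloid n l)) :=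
  Representation.ofMulAction ℚ (Equiv.Perm (Fin n)) (Tabloid n l)

/-- The column of the entry `a` in `t`. -/
def Tableau.col {n : ℕ} {l : List ℕ} (t : Tableau n l) (a : Fin n) : ℕ := (t a).2

/-- The column stabiliser of `t`: the permutations which keep every entry in its column. -/
def Tableau.colStab {n : ℕ} {l : List ℕ} (t : Tableau n l) : Finset (Equiv.Perm (Fin n)) :=
  Finset.univ.filter fun π => ∀ a, t.col (π a) = t.col a

/-- The polytabloid `e_t = ∑ sgn(π) π{t}`, the sum over the column stabiliser of `t`. -/
def Tableau.polytabloid {n : ℕ} {l : List ℕ} (t : Tableau n l) :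
    MonoidAlgebra ℚ (Tabloid n l) :=
  ∑ π ∈ t.colStab, MonoidAlgebra.single (π • t.tabloid) ((Equiv.Perm.sign π : ℤ) : ℚ)

/-- `σ e_t = e_{σt}`, where `σt` is obtained from `t` by replacing each entry `a` by `σ a`. -/
theorem tabloidRep_polytabloid {n : ℕ} {l : List ℕ} (σ : Equiv.Perm (Fin n))
    (t : Tableau n l) :
    tabloidRep n l σ t.polytabloid
      = Tableau.polytabloid (σ.symm.trans t : Tableau n l) := by
  unfold Tableau.polytabloid
  rw [map_sum]
  refine Finset.sum_bij' (fun π _ => σ * π * σ⁻¹) (fun π _ => σ⁻¹ * π * σ) ?_ ?_ ?_ ?_ ?_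
  · intro π hπ
    simp only [Tableau.colStab, Finset.mem_filter, Finset.mem_univ, true_and] at hπ ⊢
    intro a
    have h : ∀ b, Tableau.col (σ.symm.trans t : Tableau n l) b = t.col (σ.symm b) := fun _ => rfl
    simpa [h] using hπ (σ⁻¹ a)
  · intro π hπ
    simp only [Tableau.colStab, Finset.mem_filter, Finset.mem_univ, true_and] at hπ ⊢
    intro a
    have h : ∀ b, Tableau.col (σ.symm.trans t : Tableau n l) b = t.col (σ.symm b) := fun _ => rfl
    simpa [h] using hπ (σ a)
  · intro π _
    group
  · intro π _
    group
  · intro π _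
    have h : Tableau.tabloid (σ.symm.trans t : Tableau n l) = σ • t.tabloid := rfl
    rw [Representation.ofMulAction_single, h, smul_smul, smul_smul]
    congr 1
    · congr 1
      group
    · have h2 : Equiv.Perm.sign (σ * π * σ⁻¹) = Equiv.Perm.sign π := by
        rw [map_mul, map_mul, map_inv, mul_right_comm, mul_inv_cancel, one_mul]
      rw [h2]

/-- The submodule spanned by all polytabloids of shape `l`. -/
def spechtSub (n : ℕ) (l : List ℕ) : Subrepresentation (tabloidRep n l) where
  toSubmodule := Submodule.span ℚ (Set.range (Tableau.polytabloid (n := n) (l := l)))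
  apply_mem_toSubmodule σ v hv := by
    have h := Submodule.mem_map_of_mem (f := tabloidRep n l σ) hv
    rw [Submodule.map_span] at h
    refine Submodule.span_mono ?_ h
    rintro _ ⟨_, ⟨t, rfl⟩, rfl⟩
    exact ⟨_, (tabloidRep_polytabloid σ t).symm⟩

/-- `V_λ`, the irreducible representation of `S_n` attached to the partition `l = λ` of `n`. -/
abbrev V (n : ℕ) (l : List ℕ) :
    Representation ℚ (Equiv.Perm (Fin n)) (spechtSub n l).toSubmodule :=
  (spechtSub n l).toRepresentation

/-- The partition `(n - ∑ μ_i, μ₁, …, μ_s)` of `n`, for `n - ∑ μ_i ≥ μ₁`; so `V(μ)_n` is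
`V n (padded n μ)`. -/
def padded (n : ℕ) (μ : List ℕ) : List ℕ := (n - μ.sum) :: μ

/-- For a list of pairs `(m, λ)`, the direct sum of the `m V_λ`, each `m V_λ` being the direct sum
of `m` copies of `V_λ`. -/
abbrev directSumV (n : ℕ) (d : List (ℕ × List ℕ)) :
    Representation ℚ (Equiv.Perm (Fin n))
      (⨁ x : (Σ i : Fin d.length, Fin (d.get i).1), (spechtSub n (d.get x.1).2).toSubmodule) :=
  Representation.directSum fun x : (Σ i : Fin d.length, Fin (d.get i).1) => V n (d.get x.1).2

end SymRep

end

open scoped DirectSum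

noncomputable section

namespace SymRep

/-! ### Polytabloids as combinations of row functions -/

/-! The decomposition follows from column antisymmetrisers and a dimension count; neither characters
nor irreducibility of the Specht modules are used. All Specht modules are carried by `toRow` into
one space, that of formal combinations of functions `Fin n → ℕ` sending each entry to its row. A
`Pattern` defines an equivariant map from this space to the exterior square, and a shape of
multiplicity `m` comes with `m` patterns for which the images of one polytabloid are linearly
independent.

Together these maps are injective on the direct sum (`eq_zero_of_sum_eq_zero`). The column sum of a
tableau kills the Specht modules of all shapes not dominated by its own (`colSum_eq_zero_of_lt`) and
maps its own Specht module into the line of its polytabloid (`colSum_mem_span`). A vector of that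
module all of whose translates are killed is orthogonal to every polytabloid, hence zero
(`eq_zero_of_colSum_eq_zero`).

Surjectivity is then a matter of dimension, and lower bounds for the Specht modules suffice. They
come from one half of the branching rule (`sum_finrank_removeCell_le`), and the resulting hook
length values add up to the dimension of the exterior square.

Uniformity in `n` comes from `Pattern.polyCoord_consFn`: lengthening the first row by an entry alone
in its column leaves the relevant coordinates unchanged, so each shape is checked by computation for
one small `n`. -/

/-- The formal rational combinations of row functions. -/
abbrev RowSpace (n : ℕ) : Type := (Fin n → ℕ) →₀ ℚ

/-- The permutation representation on combinations of row functions. -/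
def rowRep (n : ℕ) : Representation ℚ (Equiv.Perm (Fin n)) (RowSpace n) where
  toFun π := Finsupp.lmapDomain ℚ ℚ fun r => r ∘ ⇑π⁻¹
  map_one' := by
    ext r : 2
    simp
  map_mul' π τ := by
    ext r : 2
    simp [Function.comp_def]

@[simp]
theorem rowRep_single {n : ℕ} (π : Equiv.Perm (Fin n)) (r : Fin n → ℕ) (a : ℚ) :
    rowRep n π (Finsupp.single r a) = Finsupp.single (r ∘ ⇑π⁻¹) a := by
  simp [rowRep]

/-- The permutations which preserve the column function `c`. -/
def colPerms {n : ℕ} (c : Fin n → ℕ) : Finset (Equiv.Perm (Fin n)) :=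
  Finset.univ.filter fun π => ∀ a, c (π a) = c a

theorem mem_colPerms {n : ℕ} {c : Fin n → ℕ} {π : Equiv.Perm (Fin n)} :
    π ∈ colPerms c ↔ ∀ a, c (π a) = c a := by
  simp [colPerms]

theorem inv_mem_colPerms {n : ℕ} {c : Fin n → ℕ} {π : Equiv.Perm (Fin n)}
    (h : π ∈ colPerms c) : π⁻¹ ∈ colPerms c := by
  rw [mem_colPerms] at *
  intro a
  have := h (π⁻¹ a)
  simpa using this.symm

theorem mul_mem_colPerms {n : ℕ} {c : Fin n → ℕ} {π τ : Equiv.Perm (Fin n)}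
    (h : π ∈ colPerms c) (h' : τ ∈ colPerms c) : π * τ ∈ colPerms c := by
  rw [mem_colPerms] at *
  intro a
  simp [h, h']

/-- The polytabloid with row function `r` and column function `c`. -/
def poly {n : ℕ} (r c : Fin n → ℕ) : RowSpace n :=
  ∑ π ∈ colPerms c, Finsupp.single (r ∘ ⇑π⁻¹) ((Equiv.Perm.sign π : ℤ) : ℚ)

/-- The signed sum over the column stabiliser acting on a representation. -/
def colSum {n : ℕ} {U : Type*} [AddCommGroup U] [Module ℚ U]
    (ρ : Representation ℚ (Equiv.Perm (Fin n)) U) (c : Fin n → ℕ) : U →ₗ[ℚ] U :=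
  ∑ π ∈ colPerms c, ((Equiv.Perm.sign π : ℤ) : ℚ) • ρ π

theorem colSum_apply {n : ℕ} {U : Type*} [AddCommGroup U] [Module ℚ U]
    (ρ : Representation ℚ (Equiv.Perm (Fin n)) U) (c : Fin n → ℕ) (u : U) :
    colSum ρ c u = ∑ π ∈ colPerms c, ((Equiv.Perm.sign π : ℤ) : ℚ) • ρ π u := by
  simp [colSum, LinearMap.sum_apply]

theorem colSum_single {n : ℕ} (r c : Fin n → ℕ) :
    colSum (rowRep n) c (Finsupp.single r 1) = poly r c := by
  simp [colSum_apply, poly]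

theorem colSum_comm {n : ℕ} {U W : Type*} [AddCommGroup U] [Module ℚ U] [AddCommGroup W]
    [Module ℚ W] {ρ : Representation ℚ (Equiv.Perm (Fin n)) U}
    {σ : Representation ℚ (Equiv.Perm (Fin n)) W} (f : U →ₗ[ℚ] W)
    (hf : ∀ π u, f (ρ π u) = σ π (f u)) (c : Fin n → ℕ) (u : U) :
    f (colSum ρ c u) = colSum σ c (f u) := by
  simp [colSum_apply, hf]

/-- `(r, c)` is a bijection onto the cells `(i, j)`, `j < lam i`. -/
structure IsTab {n : ℕ} (lam : ℕ → ℕ) (r c : Fin n → ℕ) : Prop where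
  inj : ∀ a b, r a = r b → c a = c b → a = b
  lt : ∀ a, c a < lam (r a)
  surj : ∀ i j, j < lam i → ∃ a, r a = i ∧ c a = j

theorem IsTab.relabel {n : ℕ} {lam : ℕ → ℕ} {r c : Fin n → ℕ} (h : IsTab lam r c)
    (g : Equiv.Perm (Fin n)) : IsTab lam (r ∘ g) (c ∘ g) where
  inj a b h1 h2 := g.injective (h.inj _ _ h1 h2)
  lt a := h.lt _
  surj i j hij := by
    obtain ⟨a, h1, h2⟩ := h.surj i j hij
    exact ⟨g.symm a, by simpa using h1, by simpa using h2⟩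

/-- Both tableaux are bijections onto the same cells, so one composed with the inverse of the other
is the relabelling. -/
theorem IsTab.exists_relabel {n : ℕ} {lam : ℕ → ℕ} {r c s d : Fin n → ℕ} (h : IsTab lam r c)
    (h' : IsTab lam s d) : ∃ g : Equiv.Perm (Fin n), s = r ∘ g ∧ d = c ∘ g := by
  choose f hf1 hf2 using fun a => h.surj (s a) (d a) (h'.lt a)
  have hinj : Function.Injective f := fun a b hab =>
    h'.inj a b (by rw [← hf1, ← hf1, hab]) (by rw [← hf2, ← hf2, hab])
  refine ⟨Equiv.ofBijective f (Finite.injective_iff_bijective.1 hinj), ?_, ?_⟩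
  · ext a; simp [hf1]
  · ext a; simp [hf2]

theorem IsTab.card_row {n : ℕ} {lam : ℕ → ℕ} {r c : Fin n → ℕ} (h : IsTab lam r c) (i : ℕ) :
    (Finset.univ.filter fun a => r a = i).card = lam i := by
  rw [← Finset.card_range (lam i)]
  refine Finset.card_bij (fun a _ => c a) ?_ ?_ ?_
  · intro a ha
    simp only [Finset.mem_filter, Finset.mem_univ, true_and] at ha
    simpa [ha] using h.lt a
  · intro a ha b hb hab
    simp only [Finset.mem_filter, Finset.mem_univ, true_and] at ha hb
    exact h.inj a b (ha.trans hb.symm) hab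
  · intro j hj
    obtain ⟨a, h1, h2⟩ := h.surj i j (by simpa using hj)
    exact ⟨a, by simpa using h1, h2⟩

/-- The span of all polytabloids of shape `lam`. -/
def rowSpecht (n : ℕ) (lam : ℕ → ℕ) : Submodule ℚ (RowSpace n) :=
  Submodule.span ℚ {v | ∃ r c, IsTab lam r c ∧ v = poly r c}

theorem rowRep_poly {n : ℕ} (g : Equiv.Perm (Fin n)) (r c : Fin n → ℕ) :
    rowRep n g (poly r c) = poly (r ∘ ⇑g⁻¹) (c ∘ ⇑g⁻¹) := by
  unfold poly
  rw [map_sum]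
  refine Finset.sum_bij' (fun π _ => g * π * g⁻¹) (fun π _ => g⁻¹ * π * g) ?_ ?_ ?_ ?_ ?_
  · intro π hπ
    rw [mem_colPerms] at *
    intro a
    simpa using hπ (g⁻¹ a)
  · intro π hπ
    rw [mem_colPerms] at *
    intro a
    simpa using hπ (g a)
  · intro π _
    group
  · intro π _
    group
  · intro π _
    rw [rowRep_single]
    congr 1
    · ext a
      simp
    · have h2 : Equiv.Perm.sign (g * π * g⁻¹) = Equiv.Perm.sign π := by
        rw [map_mul, map_mul, map_inv, mul_right_comm, mul_inv_cancel, one_mul]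
      rw [h2]

theorem rowRep_mem_rowSpecht {n : ℕ} {lam : ℕ → ℕ} (g : Equiv.Perm (Fin n)) {v : RowSpace n}
    (hv : v ∈ rowSpecht n lam) : rowRep n g v ∈ rowSpecht n lam := by
  have h := Submodule.mem_map_of_mem (f := rowRep n g) hv
  rw [rowSpecht, Submodule.map_span] at h
  refine Submodule.span_mono ?_ h
  rintro _ ⟨_, ⟨r, c, hrc, rfl⟩, rfl⟩
  exact ⟨_, _, hrc.relabel g⁻¹, rowRep_poly g r c⟩

/-! ### Comparison with the Specht modules -/

/-- The row function of a tabloid. -/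
def Tabloid.rowFn {n : ℕ} {l : List ℕ} (x : Tabloid n l) : Fin n → ℕ := fun a => x.1 a

theorem Tabloid.rowFn_injective {n : ℕ} {l : List ℕ} :
    Function.Injective (Tabloid.rowFn (n := n) (l := l)) := by
  intro x y h
  exact Subtype.ext (funext fun a => Fin.ext (congrFun h a))

/-- The embedding of the tabloid module into the space of combinations of row functions. -/
def toRow (n : ℕ) (l : List ℕ) : MonoidAlgebra ℚ (Tabloid n l) →ₗ[ℚ] RowSpace n :=
  Finsupp.lmapDomain ℚ ℚ Tabloid.rowFn ∘ₗ (MonoidAlgebra.coeffLinearEquiv ℚ).toLinearMap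

@[simp]
theorem toRow_single {n : ℕ} {l : List ℕ} (x : Tabloid n l) (a : ℚ) :
    toRow n l (MonoidAlgebra.single x a) = Finsupp.single x.rowFn a := by
  simp [toRow]

theorem toRow_injective (n : ℕ) (l : List ℕ) : Function.Injective (toRow n l) := by
  unfold toRow
  rw [LinearMap.coe_comp]
  exact (Finsupp.mapDomain_injective Tabloid.rowFn_injective).comp (LinearEquiv.injective _)

theorem toRow_tabloidRep {n : ℕ} {l : List ℕ} (π : Equiv.Perm (Fin n))
    (v : MonoidAlgebra ℚ (Tabloid n l)) :
    toRow n l (tabloidRep n l π v) = rowRep n π (toRow n l v) := by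
  induction v using MonoidAlgebra.induction_linear with
  | zero => simp
  | add x y hx hy => simp [hx, hy]
  | single x a =>
    rw [Representation.ofMulAction_single, toRow_single, toRow_single, rowRep_single]
    rfl

/-- The row lengths of a list, continued by zero. -/
def shape (l : List ℕ) : ℕ → ℕ := fun i => l.getD i 0

theorem toRow_polytabloid {n : ℕ} {l : List ℕ} (t : Tableau n l) :
    toRow n l t.polytabloid = poly (fun a => ((t a).1 : ℕ)) t.col := by
  unfold Tableau.polytabloid poly
  rw [map_sum]
  refine Finset.sum_congr rfl fun π _ => ?_
  rw [toRow_single]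
  rfl

theorem Tableau.isTab {n : ℕ} {l : List ℕ} (t : Tableau n l) :
    IsTab (shape l) (fun a => ((t a).1 : ℕ)) t.col where
  inj a b h1 h2 := by
    apply t.injective
    have h1' : (t a).1 = (t b).1 := Fin.ext h1
    refine Sigma.ext h1' ?_
    rw [Fin.heq_ext_iff (by rw [h1'])]
    exact h2
  lt a := by
    simp [shape, Tableau.col]
  surj i j hij := by
    have hi : i < l.length := by
      by_contra hi
      simp [shape, List.getElem?_eq_none (not_lt.1 hi)] at hij
    have hj : j < l.get ⟨i, hi⟩ := by simpa [shape, hi] using hij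
    have ht := t.apply_symm_apply ⟨⟨i, hi⟩, ⟨j, hj⟩⟩
    exact ⟨_, congrArg (fun x => (x.1 : ℕ)) ht, congrArg (fun x => (x.2 : ℕ)) ht⟩

theorem IsTab.exists_tableau {n : ℕ} {l : List ℕ} {r c : Fin n → ℕ} (h : IsTab (shape l) r c) :
    ∃ t : Tableau n l, (fun a => ((t a).1 : ℕ)) = r ∧ t.col = c := by
  have hr : ∀ a, r a < l.length := by
    intro a
    by_contra hi
    have := h.lt a
    simp [shape, List.getElem?_eq_none (not_lt.1 hi)] at this
  have hc : ∀ a, c a < l.get ⟨r a, hr a⟩ := by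
    intro a
    simpa [shape, hr a] using h.lt a
  let f : Fin n → Σ i : Fin l.length, Fin (l.get i) := fun a => ⟨⟨r a, hr a⟩, ⟨c a, hc a⟩⟩
  have hf : Function.Bijective f := by
    constructor
    · intro a b hab
      have h1 : r a = r b := congrArg (fun x => (x.1 : ℕ)) hab
      have h2 : c a = c b := congrArg (fun x => (x.2 : ℕ)) hab
      exact h.inj a b h1 h2
    · rintro ⟨⟨i, hi⟩, ⟨j, hj⟩⟩
      obtain ⟨a, rfl, rfl⟩ := h.surj i j (by simpa [shape, hi] using hj)
      exact ⟨a, rfl⟩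
  exact ⟨Equiv.ofBijective f hf, rfl, rfl⟩

theorem map_toRow_spechtSub (n : ℕ) (l : List ℕ) :
    (spechtSub n l).toSubmodule.map (toRow n l) = rowSpecht n (shape l) := by
  unfold spechtSub rowSpecht
  simp only
  rw [Submodule.map_span]
  congr 1
  ext v
  constructor
  · rintro ⟨_, ⟨t, rfl⟩, rfl⟩
    exact ⟨_, _, t.isTab, toRow_polytabloid t⟩
  · rintro ⟨r, c, h, rfl⟩
    obtain ⟨t, rfl, rfl⟩ := h.exists_tableau
    exact ⟨_, ⟨t, rfl⟩, toRow_polytabloid t⟩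

theorem finrank_spechtSub (n : ℕ) (l : List ℕ) :
    Module.finrank ℚ (spechtSub n l).toSubmodule = Module.finrank ℚ (rowSpecht n (shape l)) := by
  rw [← map_toRow_spechtSub]
  exact (Submodule.equivMapOfInjective _ (toRow_injective n l) _).finrank_eq

/-- All tableaux of one shape are relabellings of any given one, and there are finitely many
permutations. This gives finite dimension, without which `Module.finrank` would carry no
information. -/
theorem finite_poly (n : ℕ) (lam : ℕ → ℕ) :
    {v : RowSpace n | ∃ r c, IsTab lam r c ∧ v = poly r c}.Finite := by
  by_cases hne : ∃ r c : Fin n → ℕ, IsTab lam r c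
  · obtain ⟨r, c, h⟩ := hne
    refine (Set.finite_range fun g : Equiv.Perm (Fin n) => poly (r ∘ g) (c ∘ g)).subset ?_
    rintro _ ⟨s, d, h', rfl⟩
    obtain ⟨g, rfl, rfl⟩ := h.exists_relabel h'
    exact ⟨g, rfl⟩
  · convert Set.finite_empty
    ext v
    simp only [Set.mem_ofPred_eq, Set.mem_empty_iff_false, iff_false]
    rintro ⟨r, c, h, -⟩
    exact hne ⟨r, c, h⟩

instance (n : ℕ) (lam : ℕ → ℕ) : Module.Finite ℚ (rowSpecht n lam) :=
  Module.Finite.iff_fg.2 (Submodule.fg_span (finite_poly n lam))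

/-! ### Column sums and dominance -/

/-- On column `j` both `s` and `r` are injective. The first bounds the count by `k`, the second by
the length of the column; the right side is the smaller of the two. -/
theorem card_col_le {n : ℕ} {lam : ℕ → ℕ} (hlam : Antitone lam) {r c s : Fin n → ℕ}
    (h : IsTab lam r c) (hs : ∀ a b, c a = c b → s a = s b → a = b) (j k : ℕ) :
    (Finset.univ.filter fun a => c a = j ∧ s a < k).card
      ≤ ((Finset.range k).filter fun i => j < lam i).card := by
  by_cases hk : ∀ i < k, j < lam i
  · rw [Finset.filter_true_of_mem (fun i hi => hk i (Finset.mem_range.1 hi))]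
    refine Finset.card_le_card_of_injOn s ?_ ?_
    · intro a ha
      simp only [Finset.coe_filter, Finset.mem_univ, true_and, Set.mem_ofPred_eq] at ha
      simpa using ha.2
    · intro a ha b hb hab
      simp only [Finset.coe_filter, Finset.mem_univ, true_and, Set.mem_ofPred_eq] at ha hb
      exact hs a b (ha.1.trans hb.1.symm) hab
  · push Not at hk
    obtain ⟨i, hik, hi⟩ := hk
    refine Finset.card_le_card_of_injOn r ?_ ?_
    · intro a ha
      simp only [Finset.coe_filter, Finset.mem_univ, true_and, Set.mem_ofPred_eq] at ha
      have hlt := h.lt a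
      rw [ha.1] at hlt
      simp only [Finset.coe_filter, Finset.mem_range, Set.mem_ofPred_eq]
      refine ⟨?_, hlt⟩
      by_contra hcon
      have := hlam (show i ≤ r a by omega)
      omega
    · intro a ha b hb hab
      simp only [Finset.coe_filter, Finset.mem_univ, true_and, Set.mem_ofPred_eq] at ha hb
      exact h.inj a b hab (ha.1.trans hb.1.symm)

/-- Double counting of the entries with `s a < k`, by column and by value of `s`. -/
theorem sum_card_col {n : ℕ} {lam : ℕ → ℕ} (hlam : Antitone lam) {r c : Fin n → ℕ}
    (h : IsTab lam r c) (s : Fin n → ℕ) (k : ℕ) :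
    ∑ j ∈ Finset.range (lam 0), (Finset.univ.filter fun a => c a = j ∧ s a < k).card
      = ∑ i ∈ Finset.range k, (Finset.univ.filter fun a => s a = i).card := by
  have h1 := Finset.card_eq_sum_card_fiberwise (s := Finset.univ.filter fun a => s a < k)
    (t := Finset.range (lam 0)) (f := c)
    (fun a _ => by simpa using (h.lt a).trans_le (hlam (Nat.zero_le _)))
  have h2 := Finset.card_eq_sum_card_fiberwise (s := Finset.univ.filter fun a => s a < k)
    (t := Finset.range k) (f := s) (fun a ha => by simpa using ha)
  simp only [Finset.filter_filter] at h1 h2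
  rw [h1] at h2
  calc _ = _ := Finset.sum_congr rfl fun j _ => by simp only [and_comm]
    _ = _ := h2
    _ = _ := Finset.sum_congr rfl fun i hi => by
      congr 1
      ext a
      simp only [Finset.mem_filter, Finset.mem_univ, true_and, and_iff_right_iff_imp]
      rintro rfl
      simpa using hi

theorem sum_card_cells {lam : ℕ → ℕ} (hlam : Antitone lam) (k : ℕ) :
    ∑ j ∈ Finset.range (lam 0), ((Finset.range k).filter fun i => j < lam i).card
      = ∑ i ∈ Finset.range k, lam i := by
  simp only [Finset.card_filter]
  rw [Finset.sum_comm]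
  refine Finset.sum_congr rfl fun i _ => ?_
  rw [← Finset.card_filter]
  have : (Finset.range (lam 0)).filter (fun j => j < lam i) = Finset.range (lam i) := by
    ext j
    have := hlam (Nat.zero_le i)
    simp only [Finset.mem_filter, Finset.mem_range]
    omega
  rw [this, Finset.card_range]

theorem sum_row_le_of_transversal {n : ℕ} {lam : ℕ → ℕ} (hlam : Antitone lam)
    {r c s : Fin n → ℕ} (h : IsTab lam r c) (hs : ∀ a b, c a = c b → s a = s b → a = b) (k : ℕ) :
    ∑ i ∈ Finset.range k, (Finset.univ.filter fun a => s a = i).card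
      ≤ ∑ i ∈ Finset.range k, lam i := by
  rw [← sum_card_col hlam h, ← sum_card_cells hlam]
  exact Finset.sum_le_sum fun j _ => card_col_le hlam h hs j k

/-- This is the equality case of dominance: the column estimates are sharp after summation, hence
sharp in each column for every `k`. Comparing `k = i` with `k = i + 1` leaves exactly one entry for
each cell of row `i`. -/
theorem isTab_of_transversal {n : ℕ} {lam : ℕ → ℕ} (hlam : Antitone lam)
    {r c s : Fin n → ℕ} (h : IsTab lam r c) (hs : ∀ a b, c a = c b → s a = s b → a = b)
    (hcard : ∀ i, (Finset.univ.filter fun a => s a = i).card = lam i) : IsTab lam s c := by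
  have key : ∀ k, ∀ j ∈ Finset.range (lam 0),
      (Finset.univ.filter fun a => c a = j ∧ s a < k).card
        = ((Finset.range k).filter fun i => j < lam i).card := by
    intro k
    rw [← Finset.sum_eq_sum_iff_of_le fun j _ => card_col_le hlam h hs j k,
      sum_card_col hlam h, sum_card_cells hlam]
    exact Finset.sum_congr rfl fun i _ => hcard i
  have cell : ∀ i, ∀ j ∈ Finset.range (lam 0),
      (Finset.univ.filter fun a => c a = j ∧ s a = i).card = if j < lam i then 1 else 0 := by
    intro i j hj
    have h1 := key (i + 1) j hj
    have h0 := key i j hj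
    have hsplit : (Finset.univ.filter fun a => c a = j ∧ s a < i + 1)
        = (Finset.univ.filter fun a => c a = j ∧ s a < i) ∪
          (Finset.univ.filter fun a => c a = j ∧ s a = i) := by
      ext a
      simp only [Finset.mem_filter, Finset.mem_univ, true_and, Finset.mem_union]
      omega
    have hdisj : Disjoint (Finset.univ.filter fun a => c a = j ∧ s a < i)
        (Finset.univ.filter fun a => c a = j ∧ s a = i) := by
      rw [Finset.disjoint_filter]
      omega
    rw [hsplit, Finset.card_union_of_disjoint hdisj, h0, Finset.range_add_one,
      Finset.filter_insert] at h1
    split_ifs at h1 ⊢ with hlt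
    · rw [Finset.card_insert_of_notMem (by simp)] at h1
      omega
    · omega
  have hc0 : ∀ a, c a ∈ Finset.range (lam 0) := fun a => by
    simpa using (h.lt a).trans_le (hlam (Nat.zero_le _))
  refine ⟨fun a b h1 h2 => hs a b h2 h1, fun a => ?_, fun i j hij => ?_⟩
  · by_contra hcon
    have := cell (s a) (c a) (hc0 a)
    rw [if_neg hcon, Finset.card_eq_zero] at this
    exact Finset.notMem_empty a (this ▸ by simp)
  · have := cell i j (by simpa using hij.trans_le (hlam (Nat.zero_le i)))
    rw [if_pos hij] at this
    obtain ⟨a, ha⟩ := Finset.card_pos.1 (this.symm ▸ Nat.one_pos)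
    simp only [Finset.mem_filter, Finset.mem_univ, true_and] at ha
    exact ⟨a, ha.2, ha.1⟩

/-- The transposition of `a` and `b` preserves both columns and `s`, so the terms of `π` and `π *
swap a b` cancel. -/
theorem colSum_single_eq_zero {n : ℕ} {c s : Fin n → ℕ} {a b : Fin n} (hab : a ≠ b)
    (hc : c a = c b) (hs : s a = s b) (q : ℚ) :
    colSum (rowRep n) c (Finsupp.single s q) = 0 := by
  have hcs : ∀ x, c (Equiv.swap a b x) = c x := fun x => by
    rw [Equiv.swap_apply_def]
    split_ifs with h1 h2
    · rw [h1, hc]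
    · rw [h2, hc]
    · rfl
  have hss : s ∘ Equiv.swap a b = s := funext fun x => by
    rw [Function.comp_apply, Equiv.swap_apply_def]
    split_ifs with h1 h2
    · rw [h1, hs]
    · rw [h2, hs]
    · rfl
  rw [colSum_apply]
  refine Finset.sum_involution (fun π _ => π * Equiv.swap a b) ?_ ?_ ?_ ?_
  · intro π _
    rw [rowRep_single, rowRep_single, mul_inv_rev, Equiv.swap_inv, Equiv.Perm.coe_mul,
      ← Function.comp_assoc, hss, ← add_smul]
    simp [Equiv.Perm.sign_swap hab]
  · intro π _ _ h
    have := congrArg (fun τ => τ a) (mul_eq_left.1 h)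
    simp only [Equiv.swap_apply_left, Equiv.Perm.one_apply] at this
    exact hab this.symm
  · intro π hπ
    exact mul_mem_colPerms hπ (mem_colPerms.2 hcs)
  · intro π _
    simp [mul_assoc]

theorem colSum_perm {n : ℕ} {U : Type*} [AddCommGroup U] [Module ℚ U]
    (ρ : Representation ℚ (Equiv.Perm (Fin n)) U) {c : Fin n → ℕ} {τ : Equiv.Perm (Fin n)}
    (hτ : τ ∈ colPerms c) (u : U) :
    colSum ρ c (ρ τ u) = ((Equiv.Perm.sign τ : ℤ) : ℚ) • colSum ρ c u := by
  rw [colSum_apply, colSum_apply, Finset.smul_sum]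
  refine Finset.sum_bij' (fun π _ => π * τ) (fun π _ => π * τ⁻¹) ?_ ?_ ?_ ?_ ?_
  · exact fun π hπ => mul_mem_colPerms hπ hτ
  · exact fun π hπ => mul_mem_colPerms hπ (inv_mem_colPerms hτ)
  · intro π _; group
  · intro π _; group
  · intro π _
    rw [map_mul ρ, map_mul Equiv.Perm.sign, Module.End.mul_apply, smul_smul]
    congr 1
    rcases Int.units_eq_one_or (Equiv.Perm.sign τ) with h | h <;> simp [h]

/-- The column sum of a tableau of shape `lam` maps every row function of content `lam` to a
multiple of the polytabloid. -/
theorem colSum_single_mem {n : ℕ} {lam : ℕ → ℕ} (hlam : Antitone lam) {r c s : Fin n → ℕ}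
    (h : IsTab lam r c) (hcard : ∀ i, (Finset.univ.filter fun a => s a = i).card = lam i) (q : ℚ) :
    colSum (rowRep n) c (Finsupp.single s q) ∈ Submodule.span ℚ {poly r c} := by
  by_cases hs : ∀ a b, c a = c b → s a = s b → a = b
  -- Both tableaux have the same column function, so the relabelling `g` lies in the column
  -- stabiliser and contributes only its sign.
  · obtain ⟨g, rfl, hg⟩ := h.exists_relabel (isTab_of_transversal hlam h hs hcard)
    have hg' : g ∈ colPerms c := mem_colPerms.2 fun a => (congrFun hg a).symm
    have : Finsupp.single (r ∘ g) q = q • rowRep n g⁻¹ (Finsupp.single r 1) := by simp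
    rw [this, map_smul, colSum_perm _ (inv_mem_colPerms hg'), colSum_single]
    exact Submodule.smul_mem _ _ (Submodule.smul_mem _ _ (Submodule.mem_span_singleton_self _))
  · push Not at hs
    obtain ⟨a, b, hc, hs, hab⟩ := hs
    rw [colSum_single_eq_zero hab hc hs]
    exact zero_mem _

/-- A row function injective on every column has content dominated by `lam`. Here it is not
dominated, so two entries of some column share a row. -/
theorem colSum_single_eq_zero_of_lt {n : ℕ} {lam mu : ℕ → ℕ} (hlam : Antitone lam)
    {r c s : Fin n → ℕ} (h : IsTab lam r c)
    (hcard : ∀ i, (Finset.univ.filter fun a => s a = i).card = mu i) {k : ℕ}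
    (hk : ∑ i ∈ Finset.range k, lam i < ∑ i ∈ Finset.range k, mu i) (q : ℚ) :
    colSum (rowRep n) c (Finsupp.single s q) = 0 := by
  by_cases hs : ∀ a b, c a = c b → s a = s b → a = b
  · have := sum_row_le_of_transversal hlam h hs k
    simp only [hcard] at this
    omega
  · push Not at hs
    obtain ⟨a, b, hc, hs, hab⟩ := hs
    exact colSum_single_eq_zero hab hc hs q

theorem card_row_perm {n : ℕ} {mu : ℕ → ℕ} {s d : Fin n → ℕ} (h : IsTab mu s d)
    (g : Equiv.Perm (Fin n)) (i : ℕ) :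
    (Finset.univ.filter fun a => (s ∘ g) a = i).card = mu i :=
  (h.relabel g).card_row i

theorem colSum_mem_span {n : ℕ} {lam : ℕ → ℕ} (hlam : Antitone lam) {r c : Fin n → ℕ}
    (h : IsTab lam r c) {v : RowSpace n} (hv : v ∈ rowSpecht n lam) :
    colSum (rowRep n) c v ∈ Submodule.span ℚ {poly r c} := by
  have : rowSpecht n lam ≤ (Submodule.span ℚ {poly r c}).comap (colSum (rowRep n) c) := by
    rw [rowSpecht, Submodule.span_le]
    rintro _ ⟨s, d, h', rfl⟩
    rw [SetLike.mem_coe, Submodule.mem_comap, poly.eq_1 s d, map_sum]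
    exact Submodule.sum_mem _ fun π _ => colSum_single_mem hlam h (card_row_perm h' _) _
  exact this hv

theorem colSum_eq_zero_of_lt {n : ℕ} {lam mu : ℕ → ℕ} (hlam : Antitone lam) {r c : Fin n → ℕ}
    (h : IsTab lam r c) {k : ℕ}
    (hk : ∑ i ∈ Finset.range k, lam i < ∑ i ∈ Finset.range k, mu i) {v : RowSpace n}
    (hv : v ∈ rowSpecht n mu) : colSum (rowRep n) c v = 0 := by
  have : rowSpecht n mu ≤ LinearMap.ker (colSum (rowRep n) c) := by
    rw [rowSpecht, Submodule.span_le]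
    rintro _ ⟨s, d, h', rfl⟩
    rw [SetLike.mem_coe, LinearMap.mem_ker, poly, map_sum]
    exact Finset.sum_eq_zero fun π _ => colSum_single_eq_zero_of_lt hlam h (card_row_perm h' _) hk _
  exact this hv

/-! ### Detecting vectors by column sums -/

/-- The standard pairing on combinations of row functions. -/
def dot {n : ℕ} (w : RowSpace n) : RowSpace n →ₗ[ℚ] ℚ := Finsupp.linearCombination ℚ w

theorem dot_single {n : ℕ} (w : RowSpace n) (s : Fin n → ℕ) (q : ℚ) :
    dot w (Finsupp.single s q) = q * w s := by
  simp [dot]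

theorem dot_self_eq_zero {n : ℕ} {w : RowSpace n} (h : dot w w = 0) : w = 0 := by
  rw [dot, Finsupp.linearCombination_apply, Finsupp.sum] at h
  ext s
  by_cases hs : s ∈ w.support
  · have := (Finset.sum_eq_zero_iff_of_nonneg fun x _ => mul_self_nonneg (w x)).1 h s hs
    simpa using this
  · simpa using hs

theorem rowRep_apply {n : ℕ} (π : Equiv.Perm (Fin n)) (w : RowSpace n) (s : Fin n → ℕ) :
    rowRep n π w s = w (s ∘ π) := by
  induction w using Finsupp.induction_linear with
  | zero => simp
  | add x y hx hy => simp [hx, hy]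
  | single x a =>
    rw [rowRep_single, Finsupp.single_apply, Finsupp.single_apply]
    congr 1
    rw [eq_iff_iff]
    constructor
    · rintro rfl
      ext; simp
    · rintro rfl
      ext; simp

/-- The column sum is self-adjoint for the standard pairing, through `π ↦ π⁻¹`. -/
theorem dot_poly {n : ℕ} (w : RowSpace n) (r c : Fin n → ℕ) :
    dot w (poly r c) = colSum (rowRep n) c w r := by
  rw [poly, map_sum, colSum_apply, Finsupp.finsetSum_apply]
  refine Finset.sum_bij' (fun π _ => π⁻¹) (fun π _ => π⁻¹)
    (fun π h => inv_mem_colPerms h) (fun π h => inv_mem_colPerms h) ?_ ?_ ?_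
  · simp
  · simp
  · intro π _
    rw [dot_single, Finsupp.smul_apply, rowRep_apply]
    simp

/-- Every polytabloid of the shape is a translate of the given one, so the hypothesis makes `v`
orthogonal to all of them. They span a space containing `v`, and the pairing is positive definite
over `ℚ`. -/
theorem eq_zero_of_colSum_eq_zero {n : ℕ} {lam : ℕ → ℕ} {r c : Fin n → ℕ}
    (h : IsTab lam r c) {v : RowSpace n} (hv : v ∈ rowSpecht n lam)
    (h0 : ∀ g, colSum (rowRep n) c (rowRep n g v) = 0) : v = 0 := by
  apply dot_self_eq_zero
  have : rowSpecht n lam ≤ LinearMap.ker (dot v) := by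
    rw [rowSpecht, Submodule.span_le]
    rintro _ ⟨s, d, h', rfl⟩
    rw [SetLike.mem_coe, LinearMap.mem_ker]
    obtain ⟨g, rfl, rfl⟩ := h.exists_relabel h'
    have h1 := dot_poly (rowRep n g v) r c
    rw [h0, Finsupp.zero_apply] at h1
    rw [dot_poly, colSum_apply, Finsupp.finsetSum_apply]
    rw [dot_poly, colSum_apply, Finsupp.finsetSum_apply] at h1
    rw [← h1]
    refine Finset.sum_bij' (fun π _ => g * π * g⁻¹) (fun π _ => g⁻¹ * π * g) ?_ ?_ ?_ ?_ ?_
    · intro π hπ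
      rw [mem_colPerms] at *
      intro a
      simpa using hπ (g⁻¹ a)
    · intro π hπ
      rw [mem_colPerms] at *
      intro a
      simpa using hπ (g a)
    · intro π _
      group
    · intro π _
      group
    · intro π _
      rw [Finsupp.smul_apply, Finsupp.smul_apply, rowRep_apply, rowRep_apply, rowRep_apply]
      have h2 : Equiv.Perm.sign (g * π * g⁻¹) = Equiv.Perm.sign π := by
        rw [map_mul, map_mul, map_inv, mul_right_comm, mul_inv_cancel, one_mul]
      rw [h2]
      congr 2
      ext a
      simp
  exact this hv

/-- Maps from Specht modules of decreasing shapes are jointly injective as soon as, for each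
shape, the images of one polytabloid are linearly independent. -/
theorem eq_zero_of_sum_eq_zero {n N : ℕ} {U : Type*} [AddCommGroup U] [Module ℚ U]
    {ρ : Representation ℚ (Equiv.Perm (Fin n)) U} {m : Fin N → ℕ} {lam : Fin N → ℕ → ℕ}
    (hlam : ∀ i, Antitone (lam i)) {r c : Fin N → Fin n → ℕ} (h : ∀ i, IsTab (lam i) (r i) (c i))
    (hdom : ∀ i j, j < i →
      ∃ k, ∑ x ∈ Finset.range k, lam i x < ∑ x ∈ Finset.range k, lam j x)
    (Φ : ∀ i, Fin (m i) → RowSpace n →ₗ[ℚ] U)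
    (hΦ : ∀ i k π v, Φ i k (rowRep n π v) = ρ π (Φ i k v))
    (hli : ∀ i, LinearIndependent ℚ fun k => Φ i k (poly (r i) (c i)))
    (v : ∀ i, Fin (m i) → RowSpace n) (hv : ∀ i k, v i k ∈ rowSpecht n (lam i))
    (h0 : ∑ i, ∑ k, Φ i k (v i k) = 0) : ∀ i k, v i k = 0 := by
  intro i
  -- The induction descends from the last shape. After the column sum of shape `i` is applied,
  -- earlier shapes vanish by dominance, later ones by induction, and shape `i` leaves a relation
  -- among the independent images of its polytabloid.
  induction i using WellFoundedGT.induction with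
  | ind i ih =>
  have step : ∀ g k, colSum (rowRep n) (c i) (rowRep n g (v i k)) = 0 := by
    intro g
    have h1 : ∑ j, ∑ k, Φ j k (colSum (rowRep n) (c i) (rowRep n g (v j k))) = 0 := by
      have := congrArg (fun u => colSum ρ (c i) (ρ g u)) h0
      simp only [map_sum, map_zero] at this
      rw [← this]
      refine Finset.sum_congr rfl fun j _ => Finset.sum_congr rfl fun k _ => ?_
      rw [colSum_comm (Φ j k) (hΦ j k), hΦ]
    rw [Finset.sum_eq_single i] at h1
    · choose a ha using fun k => Submodule.mem_span_singleton.1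
        (colSum_mem_span (hlam i) (h i) (rowRep_mem_rowSpecht g (hv i k)))
      simp only [← ha, map_smul] at h1
      have h2 := Fintype.linearIndependent_iff.1 (hli i) a h1
      intro k
      rw [← ha, h2, zero_smul]
    · intro j _ hj
      refine Finset.sum_eq_zero fun k _ => ?_
      rcases lt_or_gt_of_ne hj with hj | hj
      · obtain ⟨x, hx⟩ := hdom i j hj
        rw [colSum_eq_zero_of_lt (hlam i) (h i) hx (rowRep_mem_rowSpecht g (hv j k)), map_zero]
      · rw [ih j hj k]
        simp
    · simp
  exact fun k => eq_zero_of_colSum_eq_zero (h i) (hv i k) fun g => step g k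

/-! ### Adding one entry, and the branching inequality -/

/-- The permutation of `Fin (n + 1)` which fixes `0` and acts as `e` on the successors. -/
def shiftPerm {n : ℕ} (e : Equiv.Perm (Fin n)) : Equiv.Perm (Fin (n + 1)) :=
  Equiv.Perm.decomposeFin.symm (0, e)

@[simp]
theorem shiftPerm_zero {n : ℕ} (e : Equiv.Perm (Fin n)) : shiftPerm e 0 = 0 := by
  simp [shiftPerm]

@[simp]
theorem shiftPerm_succ {n : ℕ} (e : Equiv.Perm (Fin n)) (x : Fin n) :
    shiftPerm e x.succ = (e x).succ := by
  simp [shiftPerm]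

@[simp]
theorem shiftPerm_inv_succ {n : ℕ} (e : Equiv.Perm (Fin n)) (x : Fin n) :
    (shiftPerm e)⁻¹ x.succ = (e⁻¹ x).succ := by
  rw [Equiv.Perm.inv_eq_iff_eq, shiftPerm_succ]
  simp

@[simp]
theorem shiftPerm_inv_zero {n : ℕ} (e : Equiv.Perm (Fin n)) : (shiftPerm e)⁻¹ 0 = 0 := by
  rw [Equiv.Perm.inv_eq_iff_eq, shiftPerm_zero]

@[simp]
theorem sign_shiftPerm {n : ℕ} (e : Equiv.Perm (Fin n)) :
    Equiv.Perm.sign (shiftPerm e) = Equiv.Perm.sign e := by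
  simp [shiftPerm, Equiv.Perm.decomposeFin.symm_sign]

theorem exists_shiftPerm {n : ℕ} {π : Equiv.Perm (Fin (n + 1))} (h : π 0 = 0) :
    ∃ e, π = shiftPerm e := by
  refine ⟨(Equiv.Perm.decomposeFin π).2, ?_⟩
  have h1 := Equiv.Perm.decomposeFin_symm_apply_zero (Equiv.Perm.decomposeFin π).1
    (Equiv.Perm.decomposeFin π).2
  rw [Prod.mk.eta, Equiv.symm_apply_apply, h] at h1
  rw [shiftPerm, h1, Prod.mk.eta, Equiv.symm_apply_apply]

/-- Prepend an entry to a row or column function. -/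
abbrev consFn {n : ℕ} (i : ℕ) (r : Fin n → ℕ) : Fin (n + 1) → ℕ := Fin.cons i r

theorem consFn_comp_shiftPerm_inv {n : ℕ} (i : ℕ) (r : Fin n → ℕ) (e : Equiv.Perm (Fin n)) :
    consFn i r ∘ ⇑(shiftPerm e)⁻¹ = consFn i (r ∘ ⇑e⁻¹) := by
  ext a
  refine Fin.cases ?_ (fun x => ?_) a
  · rw [Function.comp_apply, shiftPerm_inv_zero, consFn, consFn, Fin.cons_zero, Fin.cons_zero]
  · rw [Function.comp_apply, shiftPerm_inv_succ, consFn, consFn, Fin.cons_succ, Fin.cons_succ,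
      Function.comp_apply]

theorem shiftPerm_mem_colPerms {n : ℕ} {p : ℕ} {c : Fin n → ℕ} {e : Equiv.Perm (Fin n)} :
    shiftPerm e ∈ colPerms (consFn p c) ↔ e ∈ colPerms c := by
  rw [mem_colPerms, mem_colPerms, Fin.forall_fin_succ]
  simp [consFn]

/-- When only the column permutations fixing `0` contribute, the sum is one over the column
stabiliser of the tableau without that entry. -/
theorem sum_colPerms_consFn {n : ℕ} {M : Type*} [AddCommMonoid M] (p : ℕ) (c : Fin n → ℕ)
    (g : Equiv.Perm (Fin (n + 1)) → M)
    (hg : ∀ π ∈ colPerms (consFn p c), π 0 ≠ 0 → g π = 0) :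
    ∑ π ∈ colPerms (consFn p c), g π = ∑ e ∈ colPerms c, g (shiftPerm e) := by
  symm
  refine Finset.sum_of_injOn shiftPerm ?_ ?_ ?_ ?_
  · intro e _ e' _ h
    ext x
    have := congrArg (fun π => π x.succ) h
    simpa [Fin.ext_iff] using this
  · intro e he
    exact shiftPerm_mem_colPerms.2 he
  · intro π hπ hne
    apply hg π hπ
    intro h0
    obtain ⟨e, rfl⟩ := exists_shiftPerm h0
    exact hne ⟨e, shiftPerm_mem_colPerms.1 hπ, rfl⟩
  · simp

/-- Remove a cell from the end of row `i`. -/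
abbrev removeCell (lam : ℕ → ℕ) (i : ℕ) : ℕ → ℕ := Function.update lam i (lam i - 1)

theorem IsTab.cons {n : ℕ} {lam : ℕ → ℕ} {i : ℕ} (hi : 0 < lam i)
    {r c : Fin n → ℕ} (h : IsTab (removeCell lam i) r c) :
    IsTab lam (consFn i r) (consFn (lam i - 1) c) := by
  have key : ∀ a, r a = i → c a < lam i - 1 := fun a ha => by
    have := h.lt a
    rw [ha] at this
    simpa using this
  refine ⟨fun a b => ?_, fun a => ?_, fun x j hj => ?_⟩
  · refine Fin.cases ?_ (fun a => ?_) a <;> refine Fin.cases ?_ (fun b => ?_) b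
    · simp
    · intro h1 h2
      simp only [consFn, Fin.cons_zero, Fin.cons_succ] at h1 h2
      have := key b h1.symm
      omega
    · intro h1 h2
      simp only [consFn, Fin.cons_zero, Fin.cons_succ] at h1 h2
      have := key a h1
      omega
    · intro h1 h2
      simp only [consFn, Fin.cons_succ] at h1 h2
      rw [h.inj a b h1 h2]
  · refine Fin.cases ?_ (fun a => ?_) a
    · simp only [consFn, Fin.cons_zero]
      omega
    · simp only [consFn, Fin.cons_succ]
      by_cases ha : r a = i
      · have := key a ha
        rw [ha]
        omega
      · have := h.lt a
        rwa [removeCell, Function.update_of_ne ha] at this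
  · by_cases hx : x = i ∧ j = lam i - 1
    · exact ⟨0, hx.1.symm, hx.2.symm⟩
    · have : j < removeCell lam i x := by
        by_cases hxi : x = i
        · subst hxi
          simp only [removeCell, Function.update_self]
          omega
        · rwa [removeCell, Function.update_of_ne hxi]
      obtain ⟨a, h1, h2⟩ := h.surj x j this
      exact ⟨a.succ, by simpa [consFn] using h1, by simpa [consFn] using h2⟩

/-- Restriction to the row functions with the entry `0` in row `i`, followed by deletion of that
entry. -/
def dropEntry (n i : ℕ) : RowSpace (n + 1) →ₗ[ℚ] RowSpace n :=
  Finsupp.linearCombination ℚ fun r => if r 0 = i then Finsupp.single (Fin.tail r) 1 else 0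

theorem dropEntry_single {n : ℕ} (i : ℕ) (r : Fin (n + 1) → ℕ) (q : ℚ) :
    dropEntry n i (Finsupp.single r q) = if r 0 = i then Finsupp.single (Fin.tail r) q else 0 := by
  rw [dropEntry, Finsupp.linearCombination_single]
  split_ifs <;> simp

/-- A column permutation that keeps `0` in row `i` keeps it in its cell, hence fixes it. -/
theorem dropEntry_poly_self {n : ℕ} {lam : ℕ → ℕ} {i p : ℕ} {r c : Fin n → ℕ}
    (h : IsTab lam (consFn i r) (consFn p c)) :
    dropEntry n i (poly (consFn i r) (consFn p c)) = poly r c := by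
  rw [poly, map_sum, sum_colPerms_consFn]
  · refine Finset.sum_congr rfl fun e _ => ?_
    rw [dropEntry_single, consFn_comp_shiftPerm_inv]
    simp [consFn]
  · intro π hπ h0
    rw [dropEntry_single, if_neg]
    intro h1
    apply h0
    have h2 := h.inj (π⁻¹ 0) 0 h1 (mem_colPerms.1 (inv_mem_colPerms hπ) 0)
    rw [Equiv.Perm.inv_eq_iff_eq] at h2
    exact h2.symm

/-- The entry `0` sits at a corner, the bottom of its column, so no column permutation carries it to
a lower row. -/
theorem dropEntry_poly_lt {n : ℕ} {lam : ℕ → ℕ} (hlam : Antitone lam) {i j : ℕ} (hij : i < j)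
    (hi : lam (i + 1) < lam i) {r c : Fin n → ℕ}
    (h : IsTab lam (consFn i r) (consFn (lam i - 1) c)) :
    dropEntry n j (poly (consFn i r) (consFn (lam i - 1) c)) = 0 := by
  rw [poly, map_sum]
  refine Finset.sum_eq_zero fun π hπ => ?_
  rw [dropEntry_single, if_neg]
  intro h1
  have h2 := h.lt (π⁻¹ 0)
  rw [mem_colPerms.1 (inv_mem_colPerms hπ) 0, show consFn i r (π⁻¹ 0) = j from h1] at h2
  have h3 := hlam (show i + 1 ≤ j from hij)
  simp only [consFn, Fin.cons_zero] at h2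
  omega

/-- The span of the polytabloids with the entry `0` at the end of one of the first `k` rows. -/
def cornerSpan (n : ℕ) (lam : ℕ → ℕ) (k : ℕ) : Submodule ℚ (RowSpace (n + 1)) :=
  Submodule.span ℚ {v | ∃ i < k, lam (i + 1) < lam i ∧ ∃ r c, IsTab (removeCell lam i) r c ∧
    v = poly (consFn i r) (consFn (lam i - 1) c)}

theorem cornerSpan_le (n : ℕ) (lam : ℕ → ℕ) (k : ℕ) :
    cornerSpan n lam k ≤ rowSpecht (n + 1) lam := by
  refine Submodule.span_mono ?_
  rintro _ ⟨i, -, hi, r, c, h, rfl⟩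
  exact ⟨_, _, h.cons (by omega), rfl⟩

instance (n : ℕ) (lam : ℕ → ℕ) (k : ℕ) : Module.Finite ℚ (cornerSpan n lam k) :=
  Submodule.finiteDimensional_of_le (cornerSpan_le n lam k)

theorem cornerSpan_mono (n : ℕ) (lam : ℕ → ℕ) (k : ℕ) :
    cornerSpan n lam k ≤ cornerSpan n lam (k + 1) := by
  refine Submodule.span_mono ?_
  rintro _ ⟨i, hik, h⟩
  exact ⟨i, by omega, h⟩

/-- The corner spans form a filtration. On step `k + 1`, `dropEntry n k` kills step `k` and its
range contains the Specht module with the corner of row `k` removed, so rank-nullity adds that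
dimension. -/
theorem sum_finrank_le_finrank_cornerSpan (n : ℕ) {lam : ℕ → ℕ} (hlam : Antitone lam) (k : ℕ) :
    ∑ i ∈ Finset.range k, (if lam (i + 1) < lam i then
      Module.finrank ℚ (rowSpecht n (removeCell lam i)) else 0)
      ≤ Module.finrank ℚ (cornerSpan n lam k) := by
  induction k with
  | zero => simp
  | succ k ih =>
    rw [Finset.sum_range_succ]
    split_ifs with hk
    · have hrn := LinearMap.finrank_range_add_finrank_ker
        ((dropEntry n k).domRestrict (cornerSpan n lam (k + 1)))
      have hrange : rowSpecht n (removeCell lam k)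
          ≤ LinearMap.range ((dropEntry n k).domRestrict (cornerSpan n lam (k + 1))) := by
        rw [rowSpecht, Submodule.span_le]
        rintro _ ⟨r, c, h, rfl⟩
        refine ⟨⟨poly (consFn k r) (consFn (lam k - 1) c), Submodule.subset_span ?_⟩, ?_⟩
        · exact ⟨k, by omega, hk, r, c, h, rfl⟩
        · exact dropEntry_poly_self (h.cons (by omega))
      have hker : (cornerSpan n lam k).comap (cornerSpan n lam (k + 1)).subtype
          ≤ LinearMap.ker ((dropEntry n k).domRestrict (cornerSpan n lam (k + 1))) := by
        have : cornerSpan n lam k ≤ LinearMap.ker (dropEntry n k) := by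
          rw [cornerSpan, Submodule.span_le]
          rintro _ ⟨i, hik, hi, r, c, h, rfl⟩
          exact dropEntry_poly_lt hlam hik hi (h.cons (by omega))
        intro x hx
        exact this hx
      have h1 := Submodule.finrank_mono hrange
      have h2 := Submodule.finrank_mono hker
      rw [(Submodule.comapSubtypeEquivOfLe (cornerSpan_mono n lam k)).finrank_eq] at h2
      omega
    · exact ih.trans (Submodule.finrank_mono (cornerSpan_mono n lam k))

theorem sum_finrank_removeCell_le (n : ℕ) {lam : ℕ → ℕ} (hlam : Antitone lam) (k : ℕ) :
    ∑ i ∈ Finset.range k, (if lam (i + 1) < lam i then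
      Module.finrank ℚ (rowSpecht n (removeCell lam i)) else 0)
      ≤ Module.finrank ℚ (rowSpecht (n + 1) lam) :=
  (sum_finrank_le_finrank_cornerSpan n hlam k).trans
    (Submodule.finrank_mono (cornerSpan_le n lam k))

/-! ### Lower bounds for the dimensions -/

/-- The dimension of the Specht module with at most four rows. -/
def dimFour (n a b c d : ℕ) : ℕ := Module.finrank ℚ (rowSpecht n (shape [a, b, c, d]))

theorem antitone_shape_four {a b c d : ℕ} (h1 : b ≤ a) (h2 : c ≤ b) (h3 : d ≤ c) :
    Antitone (shape [a, b, c, d]) := by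
  refine antitone_nat_of_succ_le fun i => ?_
  match i with
  | 0 => simpa [shape]
  | 1 => simpa [shape]
  | 2 => simpa [shape]
  | 3 => simp [shape]
  | i + 4 => simp [shape]

theorem dimFour_succ (n : ℕ) {a b c d : ℕ} (h1 : b ≤ a) (h2 : c ≤ b) (h3 : d ≤ c) :
    (if b < a then dimFour n (a - 1) b c d else 0) + (if c < b then dimFour n a (b - 1) c d else 0)
      + (if d < c then dimFour n a b (c - 1) d else 0) + (if 0 < d then dimFour n a b c (d - 1) else 0)
      ≤ dimFour (n + 1) a b c d := by
  have h := sum_finrank_removeCell_le n (antitone_shape_four h1 h2 h3) 4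
  have e0 : removeCell (shape [a, b, c, d]) 0 = shape [a - 1, b, c, d] := by
    ext i
    match i with
    | 0 => simp [shape]
    | i + 1 => simp [shape]
  have e1 : removeCell (shape [a, b, c, d]) 1 = shape [a, b - 1, c, d] := by
    ext i
    match i with
    | 0 => simp [shape]
    | 1 => simp [shape]
    | i + 2 => simp [shape]
  have e2 : removeCell (shape [a, b, c, d]) 2 = shape [a, b, c - 1, d] := by
    ext i
    match i with
    | 0 => simp [shape]
    | 1 => simp [shape]
    | 2 => simp [shape]
    | i + 3 => simp [shape]
  have e3 : removeCell (shape [a, b, c, d]) 3 = shape [a, b, c, d - 1] := by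
    ext i
    match i with
    | 0 => simp [shape]
    | 1 => simp [shape]
    | 2 => simp [shape]
    | 3 => simp [shape]
    | i + 4 => simp [shape]
  simp only [Finset.sum_range_succ, Finset.sum_range_zero, zero_add] at h
  rw [e0, e1, e2, e3] at h
  exact h

theorem dimFour_zero : 1 ≤ dimFour 0 0 0 0 0 := by
  rw [dimFour, Submodule.one_le_finrank_iff]
  intro h
  have hmem : poly (n := 0) Fin.elim0 Fin.elim0 ∈ rowSpecht 0 (shape [0, 0, 0, 0]) := by
    refine Submodule.subset_span ⟨_, _, ⟨fun a => a.elim0, fun a => a.elim0, fun i j hj => ?_⟩, rfl⟩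
    exfalso
    match i with
    | 0 | 1 | 2 | 3 => simp [shape] at hj
    | i + 4 => simp [shape] at hj
  rw [h, Submodule.mem_bot] at hmem
  have h2 : colPerms (n := 0) Fin.elim0 = {1} := by
    ext π
    simp [mem_colPerms, Subsingleton.elim π 1]
  rw [poly, h2, Finset.sum_singleton, Finsupp.single_eq_zero] at hmem
  simp at hmem

theorem le_dimFour_row (p : ℕ) : 1 ≤ dimFour p p 0 0 0 := by
  induction p with
  | zero => exact dimFour_zero
  | succ p ih =>
    have h := dimFour_succ p (a := p + 1) (b := 0) (c := 0) (d := 0) (by omega) le_rfl le_rfl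
    simp at h
    omega

/-- This bound and the next ones are hook length values with denominators cleared, by induction on
the first row. Each starts one step below a valid shape, where the polynomial vanishes; the
following case has no removable cell in its first row, which matches that zero. -/
theorem le_dimFour_one (p : ℕ) : (p : ℤ) ≤ dimFour (p + 1) p 1 0 0 := by
  induction p with
  | zero => simp
  | succ p ih =>
    have h := dimFour_succ (p + 1) (a := p + 1) (b := 1) (c := 0) (d := 0) (by omega) (by omega)
      le_rfl
    have h0 := le_dimFour_row (p + 1)
    rcases Nat.eq_zero_or_pos p with rfl | hp
    · norm_num at h h0 ⊢
      omega
    · simp [hp] at h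
      push_cast
      omega

theorem le_dimFour_two (p : ℕ) (hp : 1 ≤ p) :
    ((p : ℤ) + 2) * (p - 1) ≤ 2 * dimFour (p + 2) p 2 0 0 := by
  induction p, hp using Nat.le_induction with
  | base => simp
  | succ p hp ih =>
    have h := dimFour_succ (p + 2) (a := p + 1) (b := 2) (c := 0) (d := 0) (by omega) (by omega)
      le_rfl
    have h0 := le_dimFour_one (p + 1)
    push_cast at h0 ⊢
    rcases hp.eq_or_lt with rfl | hp
    · simp at h ⊢
      norm_num at h0
      omega
    · simp [show 2 < p + 1 by omega] at h
      zify at h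
      linarith

theorem le_dimFour_one_one (p : ℕ) :
    ((p : ℤ) + 1) * p ≤ 2 * dimFour (p + 2) p 1 1 0 := by
  induction p with
  | zero => simp
  | succ p ih =>
    have h := dimFour_succ (p + 2) (a := p + 1) (b := 1) (c := 1) (d := 0) (by omega) (by omega)
      (by omega)
    have h0 := le_dimFour_one (p + 1)
    push_cast at h0 ⊢
    rcases Nat.eq_zero_or_pos p with rfl | hp
    · simp at h ⊢
      norm_num at h0
      omega
    · simp [hp] at h
      zify at h
      linarith

theorem le_dimFour_three (p : ℕ) (hp : 2 ≤ p) :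
    ((p : ℤ) + 3) * (p + 2) * (p - 2) ≤ 6 * dimFour (p + 3) p 3 0 0 := by
  induction p, hp using Nat.le_induction with
  | base => simp
  | succ p hp ih =>
    have h := dimFour_succ (p + 3) (a := p + 1) (b := 3) (c := 0) (d := 0) (by omega) (by omega)
      le_rfl
    have h0 := le_dimFour_two (p + 1) (by omega)
    push_cast at h0 ⊢
    rcases hp.eq_or_lt with rfl | hp
    · simp at h ⊢
      norm_num at h0
      omega
    · simp [show 3 < p + 1 by omega] at h
      zify at h
      linarith

theorem le_dimFour_two_one (p : ℕ) (hp : 1 ≤ p) :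
    ((p : ℤ) + 3) * (p + 1) * (p - 1) ≤ 3 * dimFour (p + 3) p 2 1 0 := by
  induction p, hp using Nat.le_induction with
  | base => simp
  | succ p hp ih =>
    have h := dimFour_succ (p + 3) (a := p + 1) (b := 2) (c := 1) (d := 0) (by omega) (by omega)
      (by omega)
    have h0 := le_dimFour_two (p + 1) (by omega)
    have h1 := le_dimFour_one_one (p + 1)
    push_cast at h0 h1 ⊢
    rcases hp.eq_or_lt with rfl | hp
    · simp at h ⊢
      norm_num at h0 h1
      omega
    · simp [show 2 < p + 1 by omega] at h
      zify at h
      linarith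

theorem le_dimFour_one_one_one (p : ℕ) :
    ((p : ℤ) + 2) * (p + 1) * p ≤ 6 * dimFour (p + 3) p 1 1 1 := by
  induction p with
  | zero => simp
  | succ p ih =>
    have h := dimFour_succ (p + 3) (a := p + 1) (b := 1) (c := 1) (d := 1) (by omega) (by omega)
      (by omega)
    have h0 := le_dimFour_one_one (p + 1)
    push_cast at h0 ⊢
    rcases Nat.eq_zero_or_pos p with rfl | hp
    · simp at h ⊢
      norm_num at h0
      omega
    · simp [hp] at h
      zify at h
      linarith

theorem le_dimFour_three_one (p : ℕ) (hp : 2 ≤ p) :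
    ((p : ℤ) + 4) * (p + 3) * (p + 1) * (p - 2) ≤ 8 * dimFour (p + 4) p 3 1 0 := by
  induction p, hp using Nat.le_induction with
  | base => simp
  | succ p hp ih =>
    have h := dimFour_succ (p + 4) (a := p + 1) (b := 3) (c := 1) (d := 0) (by omega) (by omega)
      (by omega)
    have h0 := le_dimFour_three (p + 1) (by omega)
    have h1 := le_dimFour_two_one (p + 1) (by omega)
    push_cast at h0 h1 ⊢
    rcases hp.eq_or_lt with rfl | hp
    · simp at h ⊢
      norm_num at h0 h1
      omega
    · simp [show 3 < p + 1 by omega] at h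
      zify at h
      linarith

/-! ### Equivariant maps into the exterior square -/

/-- The unordered pair of two distinct elements. -/
def mkEdge {n : ℕ} (i j : Fin n) (h : i ≠ j) : Edge n := ⟨s(i, j), by simpa using h⟩

theorem mkEdge_eq_iff {n : ℕ} {i j a b : Fin n} (h : i ≠ j) (h' : a ≠ b) :
    mkEdge i j h = mkEdge a b h' ↔ (i = a ∧ j = b) ∨ (i = b ∧ j = a) := by
  rw [← Sym2.eq_iff]
  exact Subtype.ext_iff

theorem smul_mkEdge {n : ℕ} (π : Equiv.Perm (Fin n)) {i j : Fin n} (h : i ≠ j) :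
    π • mkEdge i j h = mkEdge (π i) (π j) (π.injective.ne h) := rfl

/-- The generator `w_ij`, which is zero for `i = j`. -/
def gen {n : ℕ} (i j : Fin n) : MonoidAlgebra ℚ (Edge n) :=
  if h : i ≠ j then MonoidAlgebra.single (mkEdge i j h) 1 else 0

/-- The coordinate belonging to the generator `w_ab`. -/
def genCoord {n : ℕ} (a b : Fin n) : Module.Dual ℚ (MonoidAlgebra ℚ (Edge n)) :=
  if h : a ≠ b then
    Finsupp.lapply (mkEdge a b h) ∘ₗ (MonoidAlgebra.coeffLinearEquiv ℚ).toLinearMap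
  else 0

theorem genCoord_gen {n : ℕ} {a b : Fin n} (hab : a ≠ b) (i j : Fin n) :
    genCoord a b (gen i j)
      = (if i = a ∧ j = b then 1 else 0) + (if i = b ∧ j = a then 1 else 0) := by
  classical
  rw [genCoord, dif_pos hab, gen]
  by_cases h : i ≠ j
  · rw [dif_pos h]
    simp only [LinearMap.comp_apply, LinearEquiv.coe_coe, MonoidAlgebra.coeffLinearEquiv_apply,
      MonoidAlgebra.coeff_single, Finsupp.lapply_apply, Finsupp.single_apply, mkEdge_eq_iff]
    by_cases h1 : i = a ∧ j = b
    · simp [h1, hab]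
    · simp [h1]
  · rw [dif_neg h, map_zero]
    rw [not_not] at h
    subst h
    rw [if_neg fun h => hab (h.1.symm.trans h.2), if_neg fun h => hab (h.2.symm.trans h.1),
      add_zero]

theorem edgeRep_gen {n : ℕ} (π : Equiv.Perm (Fin n)) (i j : Fin n) :
    edgeRep n π (gen i j) = gen (π i) (π j) := by
  unfold gen
  by_cases h : i ≠ j
  · rw [dif_pos h, dif_pos (π.injective.ne h), Representation.ofMulAction_single, smul_mkEdge]
  · rw [dif_neg h, dif_neg (by simpa using h), map_zero]

/-- The wedge of two generators. -/
def wedge {n : ℕ} (i j k l : Fin n) : ⋀[ℚ]^2 (MonoidAlgebra ℚ (Edge n)) :=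
  exteriorPower.ιMulti ℚ 2 ![gen i j, gen k l]

theorem lambdaTwo_wedge {n : ℕ} (π : Equiv.Perm (Fin n)) (i j k l : Fin n) :
    LambdaTwo n π (wedge i j k l) = wedge (π i) (π j) (π k) (π l) := by
  change exteriorPower.map 2 (edgeRep n π) _ = _
  rw [wedge, exteriorPower.map_apply_ιMulti, wedge]
  congr 1
  ext x : 1
  fin_cases x
  · exact edgeRep_gen π i j
  · exact edgeRep_gen π k l

/-- The coordinate belonging to `w_ab ∧ w_xy`. -/
def wedgeCoord {n : ℕ} (a b x y : Fin n) : ⋀[ℚ]^2 (MonoidAlgebra ℚ (Edge n)) →ₗ[ℚ] ℚ :=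
  exteriorPower.pairingDual ℚ _ 2 (exteriorPower.ιMulti ℚ 2 ![genCoord a b, genCoord x y])

theorem wedgeCoord_wedge {n : ℕ} (a b x y i j k l : Fin n) :
    wedgeCoord a b x y (wedge i j k l)
      = genCoord a b (gen i j) * genCoord x y (gen k l)
        - genCoord x y (gen i j) * genCoord a b (gen k l) := by
  rw [wedgeCoord, wedge, exteriorPower.pairingDual_ιMulti_ιMulti, Matrix.det_fin_two]
  simp

/-- Types of pairs of generators, together with the rows of their indices: `star y z` stands for
`w_ij ∧ w_ik` with `i`, `j`, `k` in the rows `0`, `y`, `z`, and `disjoint` stands for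
`w_ij ∧ w_kl` with `i`, `j`, `k`, `l` distinct and in the rows `0`, `0`, `0`, `1`. -/
inductive Pattern : Type
  | star (y z : ℕ)
  | disjoint

/-- The indicator function of a pattern. -/
def Pattern.ind {n : ℕ} (r : Fin n → ℕ) (i j k l : Fin n) : Pattern → ℤ
  | .star y z => if i = k ∧ j ≠ l ∧ r i = 0 ∧ r j = y ∧ r l = z then 1 else 0
  | .disjoint => if i ≠ j ∧ i ≠ k ∧ i ≠ l ∧ j ≠ k ∧ j ≠ l ∧ k ≠ l ∧
      r i = 0 ∧ r j = 0 ∧ r k = 0 ∧ r l = 1 then 1 else 0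

theorem Pattern.ind_perm {n : ℕ} (P : Pattern) (r : Fin n → ℕ) (π : Equiv.Perm (Fin n))
    (i j k l : Fin n) : P.ind (r ∘ ⇑π⁻¹) (π i) (π j) (π k) (π l) = P.ind r i j k l := by
  cases P <;> simp [Pattern.ind]

theorem Pattern.ind_consFn {n : ℕ} (P : Pattern) (r : Fin n → ℕ) (p : ℕ)
    (i j k l : Fin n) :
    P.ind (consFn p r) i.succ j.succ k.succ l.succ = P.ind r i j k l := by
  cases P <;> simp [Pattern.ind]

/-- The sum of all `w_ij ∧ w_kl` which match the pattern `P`. -/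
def Pattern.vec {n : ℕ} (P : Pattern) (r : Fin n → ℕ) : ⋀[ℚ]^2 (MonoidAlgebra ℚ (Edge n)) :=
  ∑ i, ∑ j, ∑ k, ∑ l, (P.ind r i j k l : ℚ) • wedge i j k l

theorem Pattern.lambdaTwo_vec {n : ℕ} (P : Pattern) (π : Equiv.Perm (Fin n)) (r : Fin n → ℕ) :
    LambdaTwo n π (P.vec r) = P.vec (r ∘ ⇑π⁻¹) := by
  simp only [Pattern.vec, map_sum, map_smul, lambdaTwo_wedge]
  symm
  rw [← Equiv.sum_comp π]
  refine Finset.sum_congr rfl fun i _ => ?_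
  rw [← Equiv.sum_comp π]
  refine Finset.sum_congr rfl fun j _ => ?_
  rw [← Equiv.sum_comp π]
  refine Finset.sum_congr rfl fun k _ => ?_
  rw [← Equiv.sum_comp π]
  exact Finset.sum_congr rfl fun l _ => by rw [Pattern.ind_perm]

/-- The linear map on combinations of row functions defined by a pattern. -/
def Pattern.map {n : ℕ} (P : Pattern) : RowSpace n →ₗ[ℚ] ⋀[ℚ]^2 (MonoidAlgebra ℚ (Edge n)) :=
  Finsupp.linearCombination ℚ P.vec

theorem Pattern.map_rowRep {n : ℕ} (P : Pattern) (π : Equiv.Perm (Fin n)) (v : RowSpace n) :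
    P.map (rowRep n π v) = LambdaTwo n π (P.map v) := by
  induction v using Finsupp.induction_linear with
  | zero => simp
  | add x y hx hy => simp only [map_add, hx, hy]
  | single r a =>
    rw [rowRep_single, Pattern.map, Finsupp.linearCombination_single,
      Finsupp.linearCombination_single, map_smul, Pattern.lambdaTwo_vec]

/-- An unordered pair arises from two ordered ones; this is why `Pattern.coord` has eight terms. -/
theorem sum_genCoord_gen {n : ℕ} {a b : Fin n} (hab : a ≠ b) (f : Fin n → Fin n → ℚ) :
    ∑ i, ∑ j, f i j * genCoord a b (gen i j) = f a b + f b a := by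
  simp only [genCoord_gen hab, mul_add, Finset.sum_add_distrib, ite_and, mul_ite, mul_one, mul_zero,
    Finset.sum_ite_irrel, Finset.sum_const_zero, Finset.sum_ite_eq', Finset.mem_univ, if_true]

/-- The coefficient of `w_ab ∧ w_xy` in the vector of a pattern. -/
def Pattern.coord {n : ℕ} (P : Pattern) (r : Fin n → ℕ) (a b x y : Fin n) : ℤ :=
  P.ind r a b x y + P.ind r a b y x + P.ind r b a x y + P.ind r b a y x
    - (P.ind r x y a b + P.ind r x y b a + P.ind r y x a b + P.ind r y x b a)

theorem wedgeCoord_vec {n : ℕ} (P : Pattern) (r : Fin n → ℕ) {a b x y : Fin n} (hab : a ≠ b)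
    (hxy : x ≠ y) : wedgeCoord a b x y (P.vec r) = P.coord r a b x y := by
  -- This is one product of the two-by-two determinant; the other follows by exchanging the two
  -- pairs.
  have key : ∀ {a b x y : Fin n}, a ≠ b → x ≠ y → ∑ i, ∑ j, ∑ k, ∑ l,
      (P.ind r i j k l : ℚ) * (genCoord a b (gen i j) * genCoord x y (gen k l))
      = P.ind r a b x y + P.ind r a b y x + P.ind r b a x y + P.ind r b a y x := by
    intro a b x y hab hxy
    have h1 : ∀ i j, ∑ k, ∑ l,
        (P.ind r i j k l : ℚ) * (genCoord a b (gen i j) * genCoord x y (gen k l))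
        = ((P.ind r i j x y : ℚ) + P.ind r i j y x) * genCoord a b (gen i j) := by
      intro i j
      rw [← sum_genCoord_gen hxy (fun k l => (P.ind r i j k l : ℚ)), Finset.sum_mul]
      refine Finset.sum_congr rfl fun k _ => ?_
      rw [Finset.sum_mul]
      exact Finset.sum_congr rfl fun l _ => by ring
    simp only [h1]
    rw [sum_genCoord_gen hab (fun i j => (P.ind r i j x y : ℚ) + P.ind r i j y x)]
    ring
  simp only [Pattern.vec, map_sum, map_smul, wedgeCoord_wedge, smul_eq_mul, mul_sub,
    Finset.sum_sub_distrib]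
  rw [key hab hxy]
  have h2 := key hxy hab
  simp only [Pattern.coord]
  push_cast
  rw [← h2]

/-- The coefficient of `w_ab ∧ w_xy` in the image of a polytabloid under the map of a pattern. -/
def Pattern.polyCoord {n : ℕ} (P : Pattern) (r c : Fin n → ℕ) (a b x y : Fin n) : ℤ :=
  ∑ π ∈ colPerms c, (Equiv.Perm.sign π : ℤ) * P.coord (r ∘ ⇑π⁻¹) a b x y

theorem wedgeCoord_map_poly {n : ℕ} (P : Pattern) (r c : Fin n → ℕ) {a b x y : Fin n}
    (hab : a ≠ b) (hxy : x ≠ y) :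
    wedgeCoord a b x y (P.map (poly r c)) = P.polyCoord r c a b x y := by
  rw [poly, map_sum, map_sum, Pattern.polyCoord]
  push_cast
  refine Finset.sum_congr rfl fun π _ => ?_
  rw [Pattern.map, Finsupp.linearCombination_single, map_smul, wedgeCoord_vec P _ hab hxy,
    smul_eq_mul]

/-- The new entry is alone in its column, so every column permutation fixes it, and coordinates
avoiding it see only the old tableau. -/
theorem Pattern.polyCoord_consFn {n : ℕ} (P : Pattern) (r c : Fin n → ℕ) (i p : ℕ)
    (hp : ∀ a, c a ≠ p) (a b x y : Fin n) :
    P.polyCoord (consFn i r) (consFn p c) a.succ b.succ x.succ y.succ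
      = P.polyCoord r c a b x y := by
  rw [Pattern.polyCoord, sum_colPerms_consFn]
  · refine Finset.sum_congr rfl fun e _ => ?_
    rw [consFn_comp_shiftPerm_inv, sign_shiftPerm]
    simp only [Pattern.coord, Pattern.ind_consFn]
  · intro π hπ h0
    obtain ⟨x, hx⟩ := Fin.exists_succ_eq.2 h0
    have := mem_colPerms.1 hπ 0
    rw [← hx] at this
    exact absurd this (hp x)

/-- There are `m` patterns and a tableau of shape `lam` such that the images of its polytabloid
are separated by coordinates. -/
def HasPatterns (n m : ℕ) (lam : ℕ → ℕ) : Prop :=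
  ∃ r c : Fin n → ℕ, IsTab lam r c ∧ ∃ P : Fin m → Pattern, ∃ q : Fin m → Fin 4 → Fin n,
    (∀ k, q k 0 ≠ q k 1 ∧ q k 2 ≠ q k 3) ∧
    ∀ k k', (P k).polyCoord r c (q k' 0) (q k' 1) (q k' 2) (q k' 3) = 0 ↔ k ≠ k'

/-- The matrix of values is diagonal with nonzero diagonal. -/
theorem linearIndependent_of_separated {m : ℕ} {U : Type*} [AddCommGroup U] [Module ℚ U]
    (u : Fin m → U) (f : Fin m → U →ₗ[ℚ] ℚ) (h : ∀ k k', f k' (u k) = 0 ↔ k ≠ k') :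
    LinearIndependent ℚ u := by
  rw [Fintype.linearIndependent_iff]
  intro g hg k
  have h1 := congrArg (f k) hg
  rw [map_sum, map_zero, Finset.sum_eq_single k] at h1
  · rw [map_smul, smul_eq_mul, mul_eq_zero, h] at h1
    simpa using h1
  · intro k' _ hk
    rw [map_smul, (h k' k).2 hk, smul_zero]
  · simp

theorem HasPatterns.exists_linearIndependent {n m : ℕ} {lam : ℕ → ℕ} (h : HasPatterns n m lam) :
    ∃ r c : Fin n → ℕ, IsTab lam r c ∧ ∃ P : Fin m → Pattern,
      LinearIndependent ℚ fun k => (P k).map (poly r c) := by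
  obtain ⟨r, c, ht, P, q, hq, h⟩ := h
  refine ⟨r, c, ht, P, linearIndependent_of_separated _
    (fun k => wedgeCoord (q k 0) (q k 1) (q k 2) (q k 3)) fun k k' => ?_⟩
  rw [wedgeCoord_map_poly _ _ _ (hq k').1 (hq k').2, Int.cast_eq_zero, h]

theorem HasPatterns.succ {n m p : ℕ} {l : List ℕ} (hl : Antitone (shape (p :: l)))
    (h : HasPatterns n m (shape (p :: l))) : HasPatterns (n + 1) m (shape ((p + 1) :: l)) := by
  obtain ⟨r, c, ht, P, q, hq, h⟩ := h
  have hs : removeCell (shape ((p + 1) :: l)) 0 = shape (p :: l) := by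
    ext i
    match i with
    | 0 => simp [shape]
    | i + 1 => simp [shape]
  have ht' : IsTab (shape ((p + 1) :: l)) (consFn 0 r) (consFn p c) :=
    IsTab.cons (i := 0) (by simp [shape]) (by rwa [hs])
  have hp : ∀ a, c a ≠ p := fun a => by
    have h1 : c a < shape (p :: l) 0 := (ht.lt a).trans_le (hl (Nat.zero_le _))
    have h2 : shape (p :: l) 0 = p := rfl
    omega
  refine ⟨_, _, ht', P, fun k x => (q k x).succ, fun k => ?_, fun k k' => ?_⟩
  · simpa using hq k
  · rw [Pattern.polyCoord_consFn _ _ _ _ _ hp, h]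

theorem antitone_shape_succ {p : ℕ} {l : List ℕ} (hl : Antitone (shape (p :: l))) :
    Antitone (shape ((p + 1) :: l)) := by
  refine antitone_nat_of_succ_le fun i => ?_
  have h := hl (Nat.le_succ i)
  match i with
  | 0 => exact h.trans (Nat.le_succ p)
  | i + 1 => exact h

theorem antitone_shape_add {p : ℕ} {l : List ℕ} (hl : Antitone (shape (p :: l))) (t : ℕ) :
    Antitone (shape ((p + t) :: l)) := by
  induction t with
  | zero => exact hl
  | succ t ih => exact antitone_shape_succ ih

theorem HasPatterns.add {n m p : ℕ} {l : List ℕ} (hl : Antitone (shape (p :: l)))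
    (h : HasPatterns n m (shape (p :: l))) (t : ℕ) :
    HasPatterns (n + t) m (shape ((p + t) :: l)) := by
  induction t with
  | zero => exact h
  | succ t ih => exact ih.succ (antitone_shape_add hl t)

/-- Bounding the row index in the surjectivity clause makes all conditions decidable for concrete
tableaux. -/
theorem isTab_shape {n : ℕ} {l : List ℕ} {r c : Fin n → ℕ}
    (h1 : ∀ a b, r a = r b → c a = c b → a = b) (h2 : ∀ a, c a < shape l (r a))
    (h3 : ∀ i < l.length, ∀ j < shape l i, ∃ a, r a = i ∧ c a = j) : IsTab (shape l) r c := by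
  refine ⟨h1, h2, fun i j hij => h3 i ?_ j hij⟩
  by_contra hi
  simp [shape, List.getElem?_eq_none (not_lt.1 hi)] at hij

/-! ### Patterns for small shapes -/

/-- In all these witnesses the tableau is filled column by column, and each chosen coordinate is a
pair of generators matching its pattern, up to order, in the tableau itself. What remains is a
finite sum over the column stabiliser. -/
theorem hasPatterns_two_one : HasPatterns 3 1 (shape [2, 1]) :=
  ⟨![0, 1, 0], ![0, 0, 1], isTab_shape (by decide) (by decide) (by decide), ![.star 0 1],
    ![![0, 1, 0, 2]], by decide, by decide +kernel⟩

theorem hasPatterns_one_one_one : HasPatterns 3 1 (shape [1, 1, 1]) :=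
  ⟨![0, 1, 2], ![0, 0, 0], isTab_shape (by decide) (by decide) (by decide), ![.star 1 2],
    ![![0, 1, 0, 2]], by decide, by decide +kernel⟩

theorem hasPatterns_three_one : HasPatterns 4 2 (shape [3, 1]) :=
  ⟨![0, 1, 0, 0], ![0, 0, 1, 2], isTab_shape (by decide) (by decide) (by decide),
    ![.star 0 1, .disjoint], ![![0, 1, 0, 2], ![0, 2, 1, 3]], by decide, by decide +kernel⟩

theorem hasPatterns_two_two : HasPatterns 4 1 (shape [2, 2]) :=
  ⟨![0, 1, 0, 1], ![0, 0, 1, 1], isTab_shape (by decide) (by decide) (by decide), ![.star 0 1],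
    ![![0, 1, 0, 2]], by decide, by decide +kernel⟩

theorem hasPatterns_three_two : HasPatterns 5 2 (shape [3, 2]) :=
  ⟨![0, 1, 0, 1, 0], ![0, 0, 1, 1, 2], isTab_shape (by decide) (by decide) (by decide),
    ![.star 0 1, .disjoint], ![![0, 1, 0, 2], ![0, 2, 1, 4]], by decide, by decide +kernel⟩

theorem hasPatterns_two_one_one : HasPatterns 4 2 (shape [2, 1, 1]) :=
  ⟨![0, 1, 2, 0], ![0, 0, 0, 1], isTab_shape (by decide) (by decide) (by decide),
    ![.star 0 1, .star 1 2], ![![0, 1, 0, 3], ![0, 1, 0, 2]], by decide, by decide +kernel⟩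

theorem hasPatterns_three_one_one : HasPatterns 5 3 (shape [3, 1, 1]) :=
  ⟨![0, 1, 2, 0, 0], ![0, 0, 0, 1, 2], isTab_shape (by decide) (by decide) (by decide),
    ![.star 0 1, .star 1 2, .disjoint], ![![0, 1, 0, 3], ![0, 1, 0, 2], ![0, 3, 1, 4]],
    by decide, by decide +kernel⟩

theorem hasPatterns_three_three : HasPatterns 6 1 (shape [3, 3]) :=
  ⟨![0, 1, 0, 1, 0, 1], ![0, 0, 1, 1, 2, 2], isTab_shape (by decide) (by decide) (by decide),
    ![.disjoint], ![![0, 2, 1, 4]], by decide, by decide +kernel⟩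

theorem hasPatterns_two_two_one : HasPatterns 5 1 (shape [2, 2, 1]) :=
  ⟨![0, 1, 2, 0, 1], ![0, 0, 0, 1, 1], isTab_shape (by decide) (by decide) (by decide),
    ![.star 0 1], ![![0, 1, 0, 3]], by decide, by decide +kernel⟩

theorem hasPatterns_three_two_one : HasPatterns 6 2 (shape [3, 2, 1]) :=
  ⟨![0, 1, 2, 0, 1, 0], ![0, 0, 0, 1, 1, 2], isTab_shape (by decide) (by decide) (by decide),
    ![.star 0 1, .disjoint], ![![0, 1, 0, 3], ![0, 3, 1, 5]], by decide, by decide +kernel⟩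

theorem hasPatterns_one_one_one_one : HasPatterns 4 1 (shape [1, 1, 1, 1]) :=
  ⟨![0, 1, 2, 3], ![0, 0, 0, 0], isTab_shape (by decide) (by decide) (by decide),
    ![.star 1 2], ![![0, 1, 0, 2]], by decide, by decide +kernel⟩

theorem hasPatterns_three_three_one : HasPatterns 7 1 (shape [3, 3, 1]) :=
  ⟨![0, 1, 2, 0, 1, 0, 1], ![0, 0, 0, 1, 1, 2, 2],
    isTab_shape (by decide) (by decide) (by decide), ![.disjoint], ![![0, 3, 1, 5]],
    by decide, by decide +kernel⟩

/-! ### The decomposition -/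

instance (n : ℕ) (l : List ℕ) : Module.Finite ℚ (spechtSub n l).toSubmodule := by
  have h : (spechtSub n l).toSubmodule.map (toRow n l) ≤ rowSpecht n (shape l) :=
    (map_toRow_spechtSub n l).le
  have := Submodule.finiteDimensional_of_le h
  exact Module.Finite.equiv (Submodule.equivMapOfInjective _ (toRow_injective n l) _).symm

instance (n : ℕ) : Fintype (Edge n) :=
  inferInstanceAs (Fintype {e : Sym2 (Fin n) // ¬ e.IsDiag})

theorem card_edge (n : ℕ) : Fintype.card (Edge n) = n.choose 2 := by
  have h := Sym2.card_subtype_not_diag (α := Fin n)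
  rw [Fintype.card_fin] at h
  rw [← h]
  exact Fintype.card_congr (Equiv.refl _)

instance (n : ℕ) : Module.Finite ℚ (MonoidAlgebra ℚ (Edge n)) :=
  Module.Finite.equiv (MonoidAlgebra.coeffLinearEquiv ℚ (S := ℚ) (M := Edge n)).symm

theorem finrank_lambdaTwo (n : ℕ) :
    Module.finrank ℚ (⋀[ℚ]^2 (MonoidAlgebra ℚ (Edge n))) = (n.choose 2).choose 2 := by
  rw [exteriorPower.finrank_eq, (MonoidAlgebra.coeffLinearEquiv ℚ).finrank_eq,
    Module.finrank_finsupp_self, card_edge]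

theorem sum_sigma_get (d : List (ℕ × List ℕ)) (f : List ℕ → ℕ) :
    ∑ x : (Σ i : Fin d.length, Fin (d.get i).1), f (d.get x.1).2
      = (d.map fun x => x.1 * f x.2).sum := by
  rw [Fintype.sum_sigma]
  simp only [Finset.sum_const, Finset.card_univ, Fintype.card_fin, smul_eq_mul]
  rw [← List.sum_ofFn]
  congr 1
  conv_rhs => rw [← List.ofFn_get d, List.map_ofFn]
  rfl

/-- A list of decreasing shapes whose multiplicities are realised by patterns and whose total
dimension is large enough decomposes the exterior square. -/
theorem nonempty_equiv_directSumV {n : ℕ} (d : List (ℕ × List ℕ))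
    (hd : ∀ x ∈ d, Antitone (shape x.2) ∧ HasPatterns n x.1 (shape x.2))
    (hdom : d.Pairwise fun x y =>
      ∃ k, ∑ i ∈ Finset.range k, shape y.2 i < ∑ i ∈ Finset.range k, shape x.2 i)
    (hdim : (n.choose 2).choose 2
      ≤ (d.map fun x => x.1 * Module.finrank ℚ (rowSpecht n (shape x.2))).sum) :
    Nonempty ((LambdaTwo n).Equiv (directSumV n d)) := by
  choose r c ht P hli using fun i : Fin d.length =>
    (hd (d.get i) (d.get_mem i)).2.exists_linearIndependent
  let Φ : ∀ x : (Σ i : Fin d.length, Fin (d.get i).1),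
      (spechtSub n (d.get x.1).2).toSubmodule →ₗ[ℚ] ⋀[ℚ]^2 (MonoidAlgebra ℚ (Edge n)) :=
    fun x => (P x.1 x.2).map ∘ₗ toRow n _ ∘ₗ Submodule.subtype _
  let Ψ : (⨁ x : (Σ i : Fin d.length, Fin (d.get i).1),
      (spechtSub n (d.get x.1).2).toSubmodule) →ₗ[ℚ] ⋀[ℚ]^2 (MonoidAlgebra ℚ (Edge n)) :=
    ∑ x, Φ x ∘ₗ DirectSum.component ℚ _ _ x
  have hΨ : ∀ v, Ψ v = ∑ x, (P x.1 x.2).map (toRow n _ (v x).1) := by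
    intro v
    rw [LinearMap.sum_apply]
    rfl
  have hequi : ∀ g v, Ψ (directSumV n d g v) = LambdaTwo n g (Ψ v) := by
    intro g v
    rw [hΨ, hΨ, map_sum]
    refine Finset.sum_congr rfl fun x _ => ?_
    rw [← Pattern.map_rowRep, ← toRow_tabloidRep]
    rfl
  have hinj : Function.Injective Ψ := by
    rw [injective_iff_map_eq_zero]
    intro v hv
    rw [hΨ, Fintype.sum_sigma] at hv
    have key := eq_zero_of_sum_eq_zero (N := d.length) (m := fun i => (d.get i).1)
      (lam := fun i => shape (d.get i).2) (ρ := LambdaTwo n)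
      (fun i => (hd _ (d.get_mem i)).1) ht
      (fun i j hij => List.pairwise_iff_get.1 hdom j i hij) (fun i k => (P i k).map)
      (fun i k => (P i k).map_rowRep) hli
      (fun i k => toRow n _ (v ⟨i, k⟩).1)
      (fun i k => map_toRow_spechtSub n _ ▸ Submodule.mem_map_of_mem (v ⟨i, k⟩).2) hv
    refine DFinsupp.ext fun x => Subtype.ext ?_
    exact toRow_injective n _ ((key x.1 x.2).trans (map_zero _).symm)
  have hfin : Module.finrank ℚ (⨁ x : (Σ i : Fin d.length, Fin (d.get i).1),
      (spechtSub n (d.get x.1).2).toSubmodule)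
      = Module.finrank ℚ (⋀[ℚ]^2 (MonoidAlgebra ℚ (Edge n))) := by
    -- Injectivity supplies one inequality, so lower bounds on the Specht dimensions suffice for the
    -- other.
    refine le_antisymm (LinearMap.finrank_le_finrank_of_injective hinj) ?_
    rw [finrank_lambdaTwo, Module.finrank_directSum]
    refine hdim.trans (le_of_eq ?_)
    rw [← sum_sigma_get d fun l => Module.finrank ℚ (rowSpecht n (shape l))]
    exact Finset.sum_congr rfl fun x _ => (finrank_spechtSub n _).symm
  have hsurj : Function.Surjective Ψ := LinearMap.range_eq_top.1
    (Submodule.eq_top_of_finrank_eq ((LinearMap.finrank_range_of_inj hinj).trans hfin))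
  refine ⟨(Representation.Equiv.mk (ρ := directSumV n d) (σ := LambdaTwo n)
    (LinearEquiv.ofBijective Ψ ⟨hinj, hsurj⟩) fun g => LinearMap.ext fun v => ?_).symm⟩
  exact hequi g v

theorem shape_two (a b : ℕ) : shape [a, b] = shape [a, b, 0, 0] := by
  ext i
  match i with
  | 0 | 1 | 2 | 3 => simp [shape]
  | i + 4 => simp [shape]

theorem shape_three (a b c : ℕ) : shape [a, b, c] = shape [a, b, c, 0] := by
  ext i
  match i with
  | 0 | 1 | 2 | 3 => simp [shape]
  | i + 4 => simp [shape]

theorem finrank_two_rows (n a b : ℕ) :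
    Module.finrank ℚ (rowSpecht n (shape [a, b])) = dimFour n a b 0 0 := by
  rw [dimFour, shape_two]

theorem finrank_three_rows (n a b c : ℕ) :
    Module.finrank ℚ (rowSpecht n (shape [a, b, c])) = dimFour n a b c 0 := by
  rw [dimFour, shape_three]

theorem finrank_four_rows (n a b c d : ℕ) :
    Module.finrank ℚ (rowSpecht n (shape [a, b, c, d])) = dimFour n a b c d := rfl

theorem antitone_shape_two {a b : ℕ} (h : b ≤ a) : Antitone (shape [a, b]) := by
  rw [shape_two]
  exact antitone_shape_four h (Nat.zero_le _) le_rfl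

theorem antitone_shape_three {a b c : ℕ} (h : b ≤ a) (h' : c ≤ b) :
    Antitone (shape [a, b, c]) := by
  rw [shape_three]
  exact antitone_shape_four h h' (Nat.zero_le _)

theorem HasPatterns.of_le {n k m p p' : ℕ} {l : List ℕ} (h : HasPatterns k m (shape (p :: l)))
    (hl : Antitone (shape (p :: l))) (hk : k ≤ n) (hp : p' = p + (n - k)) :
    HasPatterns n m (shape (p' :: l)) := by
  have := h.add hl (n - k)
  rwa [Nat.add_sub_cancel' hk, ← hp] at this

theorem two_mul_choose_two (n : ℕ) : 2 * ((n.choose 2 : ℕ) : ℤ) = n * (n - 1) := by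
  induction n with
  | zero => simp
  | succ n ih =>
    rw [Nat.choose_succ_succ', Nat.choose_one_right]
    push_cast
    linarith

theorem lambdaTwo_decomposition {n : ℕ} (hn : 7 ≤ n) :
    Nonempty ((LambdaTwo n).Equiv (directSumV n
      [(2, padded n [1]), (2, padded n [2]), (3, padded n [1, 1]), (1, padded n [3]),
        (2, padded n [2, 1]), (1, padded n [1, 1, 1]), (1, padded n [3, 1])])) := by
  have e1 : padded n [1] = [n - 1, 1] := rfl
  have e2 : padded n [2] = [n - 2, 2] := rfl
  have e3 : padded n [1, 1] = [n - 2, 1, 1] := rfl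
  have e4 : padded n [3] = [n - 3, 3] := rfl
  have e5 : padded n [2, 1] = [n - 3, 2, 1] := rfl
  have e6 : padded n [1, 1, 1] = [n - 3, 1, 1, 1] := rfl
  have e7 : padded n [3, 1] = [n - 4, 3, 1] := rfl
  rw [e1, e2, e3, e4, e5, e6, e7]
  apply nonempty_equiv_directSumV
  · simp only [List.forall_mem_cons, List.not_mem_nil, IsEmpty.forall_iff, implies_true, and_true]
    refine ⟨⟨antitone_shape_two (by omega), ?_⟩, ⟨antitone_shape_two (by omega), ?_⟩,
      ⟨antitone_shape_three (by omega) le_rfl, ?_⟩, ⟨antitone_shape_two (by omega), ?_⟩,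
      ⟨antitone_shape_three (by omega) (by omega), ?_⟩,
      ⟨antitone_shape_four (by omega) le_rfl le_rfl, ?_⟩,
      ⟨antitone_shape_three (by omega) (by omega), ?_⟩⟩
    · exact hasPatterns_three_one.of_le (antitone_shape_two (by omega)) (by omega) (by omega)
    · exact hasPatterns_three_two.of_le (antitone_shape_two (by omega)) (by omega) (by omega)
    · exact hasPatterns_three_one_one.of_le (antitone_shape_three (by omega) le_rfl) (by omega)
        (by omega)
    · exact hasPatterns_three_three.of_le (antitone_shape_two (by omega)) (by omega) (by omega)
    · exact hasPatterns_three_two_one.of_le (antitone_shape_three (by omega) (by omega)) (by omega)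
        (by omega)
    · exact hasPatterns_one_one_one_one.of_le (antitone_shape_four le_rfl le_rfl le_rfl) (by omega)
        (by omega)
    · exact hasPatterns_three_three_one.of_le (antitone_shape_three le_rfl (by omega)) (by omega)
        (by omega)
  · simp only [List.pairwise_cons, List.forall_mem_cons, List.not_mem_nil, IsEmpty.forall_iff,
      implies_true, and_true, List.Pairwise.nil]
    -- Of any two shapes in the list, the later has a shorter first row, or an equal first row and a
    -- shorter second one.
    refine ⟨⟨?_, ?_, ?_, ?_, ?_, ?_⟩, ⟨?_, ?_, ?_, ?_, ?_⟩, ⟨?_, ?_, ?_, ?_⟩, ⟨?_, ?_, ?_⟩,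
      ⟨?_, ?_⟩, ?_⟩ <;>
    first
    | exact ⟨1, by simp [shape]; omega⟩
    | exact ⟨2, by simp [shape, Finset.sum_range_succ]⟩
  -- Writing `n = p + 4` resolves every truncated subtraction. The hook length polynomials then sum
  -- exactly to the dimension, as polynomials in `p`.
  · obtain ⟨p, rfl⟩ := Nat.exists_eq_add_of_le' (show 4 ≤ n by omega)
    have h1 := le_dimFour_one (p + 3)
    have h2 := le_dimFour_two (p + 2) (by omega)
    have h3 := le_dimFour_one_one (p + 2)
    have h4 := le_dimFour_three (p + 1) (by omega)
    have h5 := le_dimFour_two_one (p + 1) (by omega)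
    have h6 := le_dimFour_one_one_one (p + 1)
    have h7 := le_dimFour_three_one p (by omega)
    have hc := two_mul_choose_two (p + 4)
    have hcc := two_mul_choose_two ((p + 4).choose 2)
    simp only [List.map_cons, List.map_nil, List.sum_cons, List.sum_nil, finrank_two_rows,
      finrank_three_rows, finrank_four_rows,
      show p + 4 - 1 = p + 3 from rfl, show p + 4 - 2 = p + 2 from rfl,
      show p + 4 - 3 = p + 1 from rfl, show p + 4 - 4 = p from rfl]
    zify
    push_cast at h1 h2 h3 h4 h5 h6 h7 hc hcc ⊢
    have hcc' : 8 * ((((p + 4).choose 2).choose 2 : ℕ) : ℤ)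
        = (p + 4) * (p + 3) * ((p + 4) * (p + 3) - 2) := by
      generalize (p + 4).choose 2 = C at hc hcc
      have hC : ((p : ℤ) + 4) * (p + 3) = 2 * C := by linarith
      rw [hC]
      linarith
    simp only [add_assoc, Nat.reduceAdd] at h1 h2 h3 h4 h5 h6 h7
    linarith

/-! ### The cases below the stable range -/

theorem lambdaTwo_two : Subsingleton (⋀[ℚ]^2 (MonoidAlgebra ℚ (Edge 2))) := by
  refine (Module.finrank_zero_iff (R := ℚ)).1 ?_
  rw [finrank_lambdaTwo]
  decide

/-- For small `n` multiplicities drop because patterns no longer fit: `.disjoint` needs three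
entries in the top row and `.star 0 1` needs two. -/
theorem lambdaTwo_three :
    Nonempty ((LambdaTwo 3).Equiv (directSumV 3 [(1, [2, 1]), (1, [1, 1, 1])])) := by
  apply nonempty_equiv_directSumV
  · simp only [List.forall_mem_cons, List.not_mem_nil, IsEmpty.forall_iff, implies_true, and_true]
    exact ⟨⟨antitone_shape_two (by omega), hasPatterns_two_one⟩,
      ⟨antitone_shape_three le_rfl le_rfl, hasPatterns_one_one_one⟩⟩
  · simp only [List.pairwise_cons, List.forall_mem_cons, List.not_mem_nil, IsEmpty.forall_iff,
      implies_true, and_true, List.Pairwise.nil]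
    exact ⟨1, by simp [shape]⟩
  · have h1 := le_dimFour_one 2
    have h2 := le_dimFour_one_one 1
    simp only [List.map_cons, List.map_nil, List.sum_cons, List.sum_nil, finrank_two_rows,
      finrank_three_rows]
    rw [show (Nat.choose 3 2).choose 2 = 3 by decide]
    norm_num at h1 h2
    omega

theorem lambdaTwo_four :
    Nonempty ((LambdaTwo 4).Equiv (directSumV 4
      [(2, [3, 1]), (1, [2, 2]), (2, [2, 1, 1]), (1, [1, 1, 1, 1])])) := by
  apply nonempty_equiv_directSumV
  · simp only [List.forall_mem_cons, List.not_mem_nil, IsEmpty.forall_iff, implies_true, and_true]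
    exact ⟨⟨antitone_shape_two (by omega), hasPatterns_three_one⟩,
      ⟨antitone_shape_two le_rfl, hasPatterns_two_two⟩,
      ⟨antitone_shape_three (by omega) le_rfl, hasPatterns_two_one_one⟩,
      ⟨antitone_shape_four le_rfl le_rfl le_rfl, hasPatterns_one_one_one_one⟩⟩
  · simp only [List.pairwise_cons, List.forall_mem_cons, List.not_mem_nil, IsEmpty.forall_iff,
      implies_true, and_true, List.Pairwise.nil]
    refine ⟨⟨?_, ?_, ?_⟩, ⟨?_, ?_⟩, ?_⟩ <;>
    first
    | exact ⟨1, by decide⟩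
    | exact ⟨2, by decide⟩
  · have h1 := le_dimFour_one 3
    have h2 := le_dimFour_two 2 (by omega)
    have h3 := le_dimFour_one_one 2
    have h4 := le_dimFour_one_one_one 1
    simp only [List.map_cons, List.map_nil, List.sum_cons, List.sum_nil, finrank_two_rows,
      finrank_three_rows, finrank_four_rows]
    rw [show (Nat.choose 4 2).choose 2 = 15 by decide]
    norm_num at h1 h2 h3 h4
    omega

theorem lambdaTwo_five :
    Nonempty ((LambdaTwo 5).Equiv (directSumV 5
      [(2, [4, 1]), (2, [3, 2]), (3, [3, 1, 1]), (1, [2, 2, 1]), (1, [2, 1, 1, 1])])) := by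
  apply nonempty_equiv_directSumV
  · simp only [List.forall_mem_cons, List.not_mem_nil, IsEmpty.forall_iff, implies_true, and_true]
    exact ⟨⟨antitone_shape_two (by omega),
        hasPatterns_three_one.of_le (antitone_shape_two (by omega)) (by omega) rfl⟩,
      ⟨antitone_shape_two (by omega), hasPatterns_three_two⟩,
      ⟨antitone_shape_three (by omega) le_rfl, hasPatterns_three_one_one⟩,
      ⟨antitone_shape_three le_rfl (by omega), hasPatterns_two_two_one⟩,
      ⟨antitone_shape_four (by omega) le_rfl le_rfl, hasPatterns_one_one_one_one.of_le
        (antitone_shape_four le_rfl le_rfl le_rfl) (by omega) rfl⟩⟩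
  · simp only [List.pairwise_cons, List.forall_mem_cons, List.not_mem_nil, IsEmpty.forall_iff,
      implies_true, and_true, List.Pairwise.nil]
    refine ⟨⟨?_, ?_, ?_, ?_⟩, ⟨?_, ?_, ?_⟩, ⟨?_, ?_⟩, ?_⟩ <;>
    first
    | exact ⟨1, by decide⟩
    | exact ⟨2, by decide⟩
  · have h1 := le_dimFour_one 4
    have h2 := le_dimFour_two 3 (by omega)
    have h3 := le_dimFour_one_one 3
    have h4 := le_dimFour_two_one 2 (by omega)
    have h5 := le_dimFour_one_one_one 2
    simp only [List.map_cons, List.map_nil, List.sum_cons, List.sum_nil, finrank_two_rows,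
      finrank_three_rows, finrank_four_rows]
    rw [show (Nat.choose 5 2).choose 2 = 45 by decide]
    norm_num at h1 h2 h3 h4 h5
    omega

theorem lambdaTwo_six :
    Nonempty ((LambdaTwo 6).Equiv (directSumV 6
      [(2, [5, 1]), (2, [4, 2]), (3, [4, 1, 1]), (1, [3, 3]), (2, [3, 2, 1]),
        (1, [3, 1, 1, 1])])) := by
  apply nonempty_equiv_directSumV
  · simp only [List.forall_mem_cons, List.not_mem_nil, IsEmpty.forall_iff, implies_true, and_true]
    exact ⟨⟨antitone_shape_two (by omega),
        hasPatterns_three_one.of_le (antitone_shape_two (by omega)) (by omega) rfl⟩,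
      ⟨antitone_shape_two (by omega),
        hasPatterns_three_two.of_le (antitone_shape_two (by omega)) (by omega) rfl⟩,
      ⟨antitone_shape_three (by omega) le_rfl, hasPatterns_three_one_one.of_le
        (antitone_shape_three (by omega) le_rfl) (by omega) rfl⟩,
      ⟨antitone_shape_two le_rfl, hasPatterns_three_three⟩,
      ⟨antitone_shape_three (by omega) (by omega), hasPatterns_three_two_one⟩,
      ⟨antitone_shape_four (by omega) le_rfl le_rfl, hasPatterns_one_one_one_one.of_le
        (antitone_shape_four le_rfl le_rfl le_rfl) (by omega) rfl⟩⟩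
  · simp only [List.pairwise_cons, List.forall_mem_cons, List.not_mem_nil, IsEmpty.forall_iff,
      implies_true, and_true, List.Pairwise.nil]
    refine ⟨⟨?_, ?_, ?_, ?_, ?_⟩, ⟨?_, ?_, ?_, ?_⟩, ⟨?_, ?_, ?_⟩, ⟨?_, ?_⟩, ?_⟩ <;>
    first
    | exact ⟨1, by decide⟩
    | exact ⟨2, by decide⟩
  · have h1 := le_dimFour_one 5
    have h2 := le_dimFour_two 4 (by omega)
    have h3 := le_dimFour_one_one 4
    have h4 := le_dimFour_three 3 (by omega)
    have h5 := le_dimFour_two_one 3 (by omega)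
    have h6 := le_dimFour_one_one_one 3
    simp only [List.map_cons, List.map_nil, List.sum_cons, List.sum_nil, finrank_two_rows,
      finrank_three_rows, finrank_four_rows]
    rw [show (Nat.choose 6 2).choose 2 = 105 by decide]
    norm_num at h1 h2 h3 h4 h5 h6
    omega

end SymRep

end

open SymRep in
theorem lemma6p4 :
    (∀ n : ℕ, 7 ≤ n → Nonempty ((LambdaTwo n).Equiv (directSumV n
      [(2, padded n [1]), (2, padded n [2]), (3, padded n [1, 1]), (1, padded n [3]),
        (2, padded n [2, 1]), (1, padded n [1, 1, 1]), (1, padded n [3, 1])]))) ∧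
    Subsingleton (⋀[ℚ]^2 (MonoidAlgebra ℚ (Edge 2))) ∧
    Nonempty ((LambdaTwo 3).Equiv (directSumV 3 [(1, [2, 1]), (1, [1, 1, 1])])) ∧
    Nonempty ((LambdaTwo 4).Equiv (directSumV 4
      [(2, [3, 1]), (1, [2, 2]), (2, [2, 1, 1]), (1, [1, 1, 1, 1])])) ∧
    Nonempty ((LambdaTwo 5).Equiv (directSumV 5
      [(2, [4, 1]), (2, [3, 2]), (3, [3, 1, 1]), (1, [2, 2, 1]), (1, [2, 1, 1, 1])])) ∧
    Nonempty ((LambdaTwo 6).Equiv (directSumV 6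
      [(2, [5, 1]), (2, [4, 2]), (3, [4, 1, 1]), (1, [3, 3]), (2, [3, 2, 1]),
        (1, [3, 1, 1, 1])])) :=
  ⟨fun _ => lambdaTwo_decomposition, lambdaTwo_two, lambdaTwo_three, lambdaTwo_four, lambdaTwo_five,
    lambdaTwo_six⟩
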